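/- Let $\xi\in H^{1/2}(\mathbb R^3)$ be complex-valued, with unitary Fourier transform $\hat\xi(p)=(2\pi)^{-3/2}\int_{\mathbb R^3}e^{-ip\cdot x}\xi(x)\,dx$ (extended to $L^2$), and let $\gamma\in\mathbb R$. For $\lambda>0$ put $$\Phi^\lambda_{\mathrm{diag}}[\xi]=12\pi\int_{\mathbb R^3}\sqrt{\tfrac34|p|^2+\lambda}\;|\hat\xi(p)|^2\,dp,\qquad \Phi^\lambda_{\mathrm{off}}[\xi]=-\frac{12}{\pi}\int_{\mathbb R^6}\frac{\overline{\hat\xi(p)}\,\hat\xi(q)}{|p|^2+|q|^2+p\cdot q+\lambda}\,dp\,dq,$$ $$\Phi_{\mathrm{reg}}[\xi]=\frac{6\gamma}{\pi}\int_{\mathbb R^6}\frac{\overline{\hat\xi(p)}\,\hat\xi(q)}{|p-q|^2}\,dp\,dq .$$ Let $K_2(s)=\int_0^\infty e^{-s\cosh t}\cosh(2t)\,dt$, $s>0$, be the Macdonald function (modified Bessel function of the second kind) of order $2$. Then for every $\xi\in H^{1/2}(\mathbb R^3)$ and $\lambda>0$ all the integrals above and below converge absolutely (for $\Phi_{\mathrm{reg}}$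 already without the factor $\gamma$), and $$\Phi^\lambda_{\mathrm{diag}}[\xi]=12\pi\sqrt\lambda\,\|\xi\|_{L^2}^2+\frac{2\sqrt3\,\lambda}{\pi}\int_{\mathbb R^6}\frac{|\xi(x)-\xi(y)|^2}{|x-y|^2}\,K_2\!\left(\sqrt{\tfrac{4\lambda}{3}}\,|x-y|\right)dx\,dy,$$ $$\Phi^\lambda_{\mathrm{off}}[\xi]=-\frac{8\sqrt3\,\lambda}{\pi}\int_{\mathbb R^6}\frac{\overline{\xi(x)}\,\xi(y)}{|x|^2+|y|^2+x\cdot y}\,K_2\!\left(\sqrt{\tfrac{4\lambda}{3}}\,\sqrt{|x|^2+|y|^2+x\cdot y}\right)dx\,dy,$$ $$\Phi_{\mathrm{reg}}[\xi]=12\pi\gamma\int_{\mathbb R^3}\frac{|\xi(x)|^2}{|x|}\,dx .$$ -/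

import Mathlib

open MeasureTheory Real
open scoped SchwartzMap ENNReal FourierTransform ComplexConjugate

noncomputable section

namespace ThreeBoson

/-- The Euclidean space `ℝ³`. -/
abbrev R3 : Type := EuclideanSpace ℝ (Fin 3)

/-- The complex Hilbert space `L²(ℝ³)`. -/
abbrev L2R3 : Type := Lp ℂ 2 (volume : Measure R3)

/-- `ξ ∈ H^{1/2}(ℝ³)`: the Sobolev (Bessel potential) space of order `1/2` over `L²`. -/
def MemHHalf (ξ : L2R3) : Prop :=
  TemperedDistribution.MemSobolev (1 / 2 : ℝ) 2 (ξ : 𝓢'(R3, ℂ))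

/-- The unitary Fourier transform on `L²(ℝ³)` in the angular-frequency convention
`ξ̂(p) = (2π)^{-3/2} ∫ e^{-i p·x} ξ(x) dx`, obtained from Mathlib's `L²` transform `𝓕`
(the extension of `w ↦ ∫ e^{-2π i w·x} ξ(x) dx`) by rescaling the frequency `p = 2π w`. -/
def hat (ξ : L2R3) (p : R3) : ℂ :=
  (((2 * π) ^ (-(3 / 2) : ℝ) : ℝ) : ℂ) * (𝓕 ξ : L2R3) ((2 * π)⁻¹ • p)

/-- The Macdonald function (modified Bessel function of the second kind) of real order `ν`, on
the positive half-line: `K_ν(x) = ∫₀^∞ e^{-x cosh t} cosh(ν t) dt` for `x > 0`. -/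
def macdonaldK (ν x : ℝ) : ℝ :=
  ∫ t in Set.Ioi (0 : ℝ), Real.exp (-x * Real.cosh t) * Real.cosh (ν * t)

/-- Integrand of `Φ^λ_diag` in momentum space. -/
def diagIntegrand (lam : ℝ) (ξ : L2R3) (p : R3) : ℝ :=
  √(3 / 4 * ‖p‖ ^ 2 + lam) * ‖hat ξ p‖ ^ 2

/-- Integrand of `Φ^λ_off` in momentum space, at the point `(p, q)`. -/
def offIntegrand (lam : ℝ) (ξ : L2R3) (z : R3 × R3) : ℂ :=
  conj (hat ξ z.1) * hat ξ z.2 /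
    ((‖z.1‖ ^ 2 + ‖z.2‖ ^ 2 + inner ℝ z.1 z.2 + lam : ℝ) : ℂ)

/-- Integrand of `Φ_reg` in momentum space, at the point `(p, q)`. -/
def regIntegrand (ξ : L2R3) (z : R3 × R3) : ℂ :=
  conj (hat ξ z.1) * hat ξ z.2 / ((‖z.1 - z.2‖ ^ 2 : ℝ) : ℂ)

/-- `Φ^λ_diag[ξ] = 12π ∫ √(¾ p² + λ) |ξ̂(p)|² dp`. -/
def PhiDiag (lam : ℝ) (ξ : L2R3) : ℝ :=
  12 * π * ∫ p : R3, diagIntegrand lam ξ p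

/-- `Φ^λ_off[ξ] = -(12/π) ∬ conj (ξ̂(p)) ξ̂(q) / (p² + q² + p·q + λ) dp dq`. -/
def PhiOff (lam : ℝ) (ξ : L2R3) : ℂ :=
  -((12 / π : ℝ) : ℂ) * ∫ z : R3 × R3, offIntegrand lam ξ z

/-- `Φ_reg[ξ] = (6γ/π) ∬ conj (ξ̂(p)) ξ̂(q) / |p - q|² dp dq`. -/
def PhiReg (γ : ℝ) (ξ : L2R3) : ℂ :=
  ((6 * γ / π : ℝ) : ℂ) * ∫ z : R3 × R3, regIntegrand ξ z

/-- Gagliardo-type integrand of `Φ^λ_diag` in position space, at the point `(x, y)`. -/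
def diagPosIntegrand (lam : ℝ) (ξ : L2R3) (z : R3 × R3) : ℝ :=
  ‖ξ z.1 - ξ z.2‖ ^ 2 / ‖z.1 - z.2‖ ^ 2 *
    macdonaldK 2 (√(4 * lam / 3) * ‖z.1 - z.2‖)

/-- Integrand of `Φ^λ_off` in position space, at the point `(x, y)`. -/
def offPosIntegrand (lam : ℝ) (ξ : L2R3) (z : R3 × R3) : ℂ :=
  conj (ξ z.1) * ξ z.2 / ((‖z.2‖ ^ 2 + ‖z.1‖ ^ 2 + inner ℝ z.1 z.2 : ℝ) : ℂ) *
    (macdonaldK 2 (√(4 * lam / 3) * √(‖z.2‖ ^ 2 + ‖z.1‖ ^ 2 + inner ℝ z.1 z.2)) : ℂ)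

end ThreeBoson

end

/-! Every kernel involved is a positive superposition of Gaussians over a parameter `t > 0`, and for
Gaussian kernels the passage from momentum to position space is an explicit computation. With `Q(x,
y) = |x|² + |y|² + x·y`, one writes `1/(Q + λ) = ∫ e^{-t(Q + λ)} dt`, `1/|p - q|² = ∫ e^{-t|p - q|²}
dt` and `√(a + λ) - √λ = (2√π)⁻¹ ∫ t^{-3/2} e^{-λt} (1 - e^{-at}) dt`.

At fixed `t`, Parseval turns `e^{-tQ}` into `(3t²)^{-3/2} e^{-Q/(3t)}` (`integral_hat_exp_offForm`),
turns `e^{-t|p - q|²}` into multiplication by a Gaussian (`integral_hat_gaussian_sub`), and relates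
`1 - e^{-|p|²/(4s)}` to a Gaussian-weighted Gagliardo form (`gagliardo_gaussian`). Integrating back
over `t`, the kernel `t⁻³ e^{-λt - Q/(3t)}` yields `6λ Q⁻¹ K₂(√(4λ/3) √Q)`
(`macdonaldK_two_subordination`).

What remains is to justify Fubini. In momentum space a Schur test with weight `|p|²` bounds the
off-diagonal and regularising forms by `∫ |p| |ξ̂|²`, finite on `H^{1/2}`. The regularising identity
then gives `∫ |ξ|²/|x| < ∞`, which through the same Schur test controls the off-diagonal form in
position space. The diagonal integrand is nonnegative, so Tonelli gives its integrability and its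
value together. -/

namespace ThreeBoson

/-! ### The Fourier transform on `L²` -/

-- Smooth compactly supported functions are Schwartz, so the fundamental lemma of the calculus of
-- variations applies. This turns identities of tempered distributions into a.e. identities of
-- functions.
open scoped ContDiff in
theorem Lp_eq_of_forall_schwartz (F : L2R3) {g : R3 → ℂ} (hg : LocallyIntegrable g)
    (h : ∀ φ : 𝓢(R3, ℂ), ∫ x, φ x • F x = ∫ x, φ x • g x) : F =ᵐ[volume] g := by
  apply ae_eq_of_integral_contDiff_smul_eq
  · exact (Lp.memLp _).locallyIntegrable (by norm_num)
  · exact hg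
  · intro k k_smooth k_cpt
    have hk₁ : HasCompactSupport (Complex.ofRealCLM ∘ k) := k_cpt.comp_left rfl
    have hk₂ : ContDiff ℝ ∞ (Complex.ofRealCLM ∘ k) := by fun_prop
    simpa using h (hk₁.toSchwartzMap hk₂)

/-- The `L²` transform agrees with the distributional one, which moves the transform onto the test
function; for integrable `h` the multiplication formula moves it back as an honest integral. -/
theorem fourier_toLp_ae_eq {h : R3 → ℂ} (h1 : Integrable h) (h2 : MemLp h 2) :
    ((𝓕 (h2.toLp h) : L2R3) : R3 → ℂ) =ᵐ[volume] 𝓕 h := by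
  have hc : Continuous (𝓕 h) :=
    VectorFourier.fourierIntegral_continuous Real.continuous_fourierChar
      (by exact continuous_inner) h1
  refine Lp_eq_of_forall_schwartz _ hc.locallyIntegrable fun φ => ?_
  have key := congrArg (fun T : 𝓢'(R3, ℂ) => T φ)
    (Lp.fourier_toTemperedDistribution_eq (h2.toLp h))
  simp only [TemperedDistribution.fourier_apply, Lp.toTemperedDistribution_apply] at key
  rw [← key]
  have e2 : ∫ x, (𝓕 φ) x • (h2.toLp h) x = ∫ x, (𝓕 φ) x • h x := by
    apply integral_congr_ae
    filter_upwards [h2.coeFn_toLp] with x hx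
    rw [hx]
  rw [e2]
  have := VectorFourier.integral_fourierIntegral_smul_eq_flip (e := Real.fourierChar)
    (L := innerₗ R3) (μ := volume) (ν := volume) Real.continuous_fourierChar
    (by exact continuous_inner) φ.integrable h1
  rw [flip_innerₗ] at this
  exact this

theorem fourierInv_toLp_ae_eq {h : R3 → ℂ} (h1 : Integrable h) (h2 : MemLp h 2) :
    ((𝓕⁻ (h2.toLp h) : L2R3) : R3 → ℂ) =ᵐ[volume] 𝓕⁻ h := by
  have hc : Continuous (𝓕⁻ h) :=
    VectorFourier.fourierIntegral_continuous (L := -innerₗ R3) Real.continuous_fourierChar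
      (by exact continuous_inner.neg) h1
  refine Lp_eq_of_forall_schwartz _ hc.locallyIntegrable fun φ => ?_
  have key := congrArg (fun T : 𝓢'(R3, ℂ) => T φ)
    (Lp.fourierInv_toTemperedDistribution_eq (h2.toLp h))
  simp only [TemperedDistribution.fourierInv_apply, Lp.toTemperedDistribution_apply] at key
  rw [← key]
  have e2 : ∫ x, (𝓕⁻ φ) x • (h2.toLp h) x = ∫ x, (𝓕⁻ φ) x • h x := by
    apply integral_congr_ae
    filter_upwards [h2.coeFn_toLp] with x hx
    rw [hx]
  rw [e2]
  have := VectorFourier.integral_fourierIntegral_smul_eq_flip (e := Real.fourierChar)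
    (L := -innerₗ R3) (μ := volume) (ν := volume) Real.continuous_fourierChar
    (by exact continuous_inner.neg) φ.integrable h1
  have hf : (-innerₗ R3).flip = -innerₗ R3 := by
    ext x y; simp [real_inner_comm]
  rw [hf] at this
  rw [SchwartzMap.fourierInv_coe]
  exact this

theorem integral_conj_fourier_mul_fourier (ξ : L2R3) {h : R3 → ℂ} (h1 : Integrable h)
    (h2 : MemLp h 2) :
    ∫ w, conj ((𝓕 ξ : L2R3) w) * 𝓕 h w = ∫ x, conj (ξ x) * h x := by
  have key := Lp.inner_fourier_eq ξ (h2.toLp h)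
  simp only [L2.inner_def] at key
  have e1 : ∫ w, conj ((𝓕 ξ : L2R3) w) * 𝓕 h w =
      ∫ w, inner ℂ ((𝓕 ξ : L2R3) w) ((𝓕 (h2.toLp h) : L2R3) w) := by
    apply integral_congr_ae
    filter_upwards [fourier_toLp_ae_eq h1 h2] with w hw
    rw [hw, RCLike.inner_apply, mul_comm]
  rw [e1, key]
  apply integral_congr_ae
  filter_upwards [h2.coeFn_toLp] with w hw
  rw [hw, RCLike.inner_apply, mul_comm]

theorem integral_conj_mul_fourierInv (ξ : L2R3) {h : R3 → ℂ} (h1 : Integrable h)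
    (h2 : MemLp h 2) :
    ∫ x, conj (ξ x) * 𝓕⁻ h x = ∫ w, conj ((𝓕 ξ : L2R3) w) * h w := by
  have key := Lp.inner_fourier_eq ξ (𝓕⁻ (h2.toLp h))
  rw [FourierTransform.fourier_fourierInv_eq] at key
  simp only [L2.inner_def] at key
  have e1 : ∫ x, conj (ξ x) * 𝓕⁻ h x =
      ∫ w, inner ℂ (ξ w) ((𝓕⁻ (h2.toLp h) : L2R3) w) := by
    apply integral_congr_ae
    filter_upwards [fourierInv_toLp_ae_eq h1 h2] with w hw
    rw [hw, RCLike.inner_apply, mul_comm]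
  rw [e1, ← key]
  apply integral_congr_ae
  filter_upwards [h2.coeFn_toLp] with w hw
  rw [hw, RCLike.inner_apply, mul_comm]

/-! ### The rescaled transform -/

theorem stronglyMeasurable_hat (ξ : L2R3) : StronglyMeasurable (hat ξ) := by
  unfold hat
  exact ((Lp.stronglyMeasurable (𝓕 ξ)).comp_measurable
    (measurable_const_smul _)).const_mul _

theorem norm_hat_sq (ξ : L2R3) (p : R3) :
    ‖hat ξ p‖ ^ 2 = (2 * π) ^ (-3 : ℝ) * ‖(𝓕 ξ : L2R3) ((2 * π)⁻¹ • p)‖ ^ 2 := by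
  unfold hat
  rw [norm_mul, mul_pow, Complex.norm_real, Real.norm_of_nonneg (by positivity),
    ← Real.rpow_natCast, ← Real.rpow_mul (by positivity)]
  norm_num

theorem integrable_norm_sq_Lp (ξ : L2R3) : Integrable (fun x => ‖ξ x‖ ^ 2) :=
  (memLp_two_iff_integrable_sq_norm (Lp.aestronglyMeasurable ξ)).1 (Lp.memLp ξ)

theorem integral_norm_sq_Lp (ξ : L2R3) : ∫ x, ‖ξ x‖ ^ 2 = ‖ξ‖ ^ 2 := by
  rw [← @inner_self_eq_norm_sq ℂ, L2.inner_def, ← integral_re]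
  · refine integral_congr_ae (.of_forall fun x => ?_)
    simp only
    rw [inner_self_eq_norm_sq (𝕜 := ℂ)]
  · exact L2.integrable_inner ξ ξ

theorem integrable_norm_hat_sq (ξ : L2R3) : Integrable (fun p => ‖hat ξ p‖ ^ 2) := by
  simp_rw [norm_hat_sq]
  exact ((integrable_norm_sq_Lp (𝓕 ξ)).comp_smul (by positivity)).const_mul _

theorem memLp_hat (ξ : L2R3) : MemLp (hat ξ) 2 :=
  (memLp_two_iff_integrable_sq_norm (stronglyMeasurable_hat ξ).aestronglyMeasurable).2
    (integrable_norm_hat_sq ξ)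

theorem integral_comp_two_pi_inv_smul {F : Type*} [NormedAddCommGroup F] [NormedSpace ℝ F]
    (f : R3 → F) : ∫ p : R3, f ((2 * π)⁻¹ • p) = (2 * π) ^ (3 : ℝ) • ∫ w, f w := by
  rw [Measure.integral_comp_inv_smul]
  simp only [finrank_euclideanSpace, Fintype.card_fin]
  rw [abs_of_pos (by positivity)]
  norm_cast

theorem integral_norm_hat_sq (ξ : L2R3) : ∫ p, ‖hat ξ p‖ ^ 2 = ‖ξ‖ ^ 2 := by
  simp_rw [norm_hat_sq]
  rw [integral_const_mul, integral_comp_two_pi_inv_smul (fun w => ‖(𝓕 ξ : L2R3) w‖ ^ 2),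
    integral_norm_sq_Lp, Lp.norm_fourier_eq, smul_eq_mul, ← mul_assoc,
    ← Real.rpow_add (by positivity)]
  norm_num

/-- Parseval's identity in the angular-frequency convention. -/
theorem integral_conj_hat_mul_fourier (ξ : L2R3) {h : R3 → ℂ} (h1 : Integrable h)
    (h2 : MemLp h 2) :
    ∫ p, conj (hat ξ p) * ∫ y, Complex.exp (-(inner ℝ p y : ℝ) * Complex.I) * h y =
      ((2 * π) ^ (3 / 2 : ℝ) : ℝ) * ∫ x, conj (ξ x) * h x := by
  have e : ∀ p : R3, conj (hat ξ p) *
      ∫ y, Complex.exp (-(inner ℝ p y : ℝ) * Complex.I) * h y =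
      ((2 * π) ^ (-(3 / 2) : ℝ) : ℝ) *
        (fun w => conj ((𝓕 ξ : L2R3) w) * 𝓕 h w) ((2 * π)⁻¹ • p) := by
    intro p
    simp only [hat, map_mul, Complex.conj_ofReal, fourier_eq', smul_eq_mul, mul_assoc]
    congr 3
    funext y
    congr 2
    rw [inner_smul_right, real_inner_comm]
    have : (π : ℂ) ≠ 0 := by exact_mod_cast pi_ne_zero
    push_cast
    field_simp
  simp_rw [e]
  rw [integral_const_mul,
    integral_comp_two_pi_inv_smul (fun w => conj ((𝓕 ξ : L2R3) w) * 𝓕 h w),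
    integral_conj_fourier_mul_fourier ξ h1 h2, Complex.real_smul, ← mul_assoc]
  congr 1
  rw [← Complex.ofReal_mul, ← Real.rpow_add (by positivity)]
  norm_num

theorem integral_conj_mul_fourierInv_hat (ξ : L2R3) {h : R3 → ℂ} (h1 : Integrable h)
    (h2 : MemLp h 2) :
    ∫ y, conj (ξ y) * ∫ p, Complex.exp ((inner ℝ p y : ℝ) * Complex.I) * h p =
      ((2 * π) ^ (3 / 2 : ℝ) : ℝ) * ∫ p, conj (hat ξ p) * h p := by
  have h1' : Integrable (fun w => h ((2 * π) • w)) := h1.comp_smul (by positivity)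
  have h2' : MemLp (fun w => h ((2 * π) • w)) 2 := by
    refine (memLp_two_iff_integrable_sq_norm ?_).2 ?_
    · exact h1'.aestronglyMeasurable
    · exact ((memLp_two_iff_integrable_sq_norm h1.aestronglyMeasurable).1 h2).comp_smul
        (R := 2 * π) (by positivity)
  have key := integral_conj_mul_fourierInv ξ h1' h2'
  have hpi : (π : ℂ) ≠ 0 := by exact_mod_cast pi_ne_zero
  have e1 : ∀ y : R3, ∫ p, Complex.exp ((inner ℝ p y : ℝ) * Complex.I) * h p =
      ((2 * π) ^ (3 : ℝ) : ℝ) * 𝓕⁻ (fun w => h ((2 * π) • w)) y := by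
    intro y
    rw [← Complex.real_smul, fourierInv_eq', ← integral_comp_two_pi_inv_smul]
    apply integral_congr_ae
    refine .of_forall fun p => ?_
    simp only [smul_eq_mul]
    rw [smul_inv_smul₀ (by positivity), inner_smul_left]
    congr 2
    simp
    field_simp
  have e2 : ∫ p, conj (hat ξ p) * h p = ((2 * π) ^ (-(3 / 2) : ℝ) : ℝ) *
      (((2 * π) ^ (3 : ℝ) : ℝ) * ∫ w, conj ((𝓕 ξ : L2R3) w) * h ((2 * π) • w)) := by
    rw [← Complex.real_smul (x := (2 * π) ^ (3 : ℝ)),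
      ← integral_comp_two_pi_inv_smul, ← integral_const_mul]
    apply integral_congr_ae
    refine .of_forall fun p => ?_
    simp only [hat, map_mul, Complex.conj_ofReal]
    rw [smul_inv_smul₀ (by positivity)]
    ring
  simp_rw [e1, e2, ← key, mul_left_comm (conj _)]
  rw [integral_const_mul, ← mul_assoc, ← mul_assoc]
  congr 1
  rw [← Complex.ofReal_mul, ← Complex.ofReal_mul, ← Real.rpow_add (by positivity),
    ← Real.rpow_add (by positivity)]
  norm_num

-- Sobolev membership provides `F ∈ L²` equal a.e. to `(1 + |w|²)^{1/4} 𝓕ξ`. Squaring the weight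
-- gives `√(1 + |w|²) ≥ |w|`, so `|F|²` dominates.
open TemperedDistribution in
theorem integrable_norm_mul_norm_hat_sq {ξ : L2R3} (hξ : MemHHalf ξ) :
    Integrable (fun p => ‖p‖ * ‖hat ξ p‖ ^ 2) := by
  obtain ⟨F, hF⟩ := memSobolev_iff_exists_smulLeftCLM_fourier.1 hξ
  have hae : ∀ᵐ w : R3, ((((1 + ‖w‖ ^ 2) ^ ((1 / 2 : ℝ) / 2) : ℝ)) : ℂ) * (𝓕 ξ : L2R3) w = F w := by
    have hmul : LocallyIntegrable
        (fun w : R3 => ((((1 + ‖w‖ ^ 2) ^ ((1 / 2 : ℝ) / 2) : ℝ)) : ℂ) * (𝓕 ξ : L2R3) w) := by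
      have := ((Lp.memLp (𝓕 ξ : L2R3)).locallyIntegrable (by norm_num)).locallyIntegrableOn Set.univ
      rw [← locallyIntegrableOn_univ]
      have hcont : ContinuousOn
          (fun w : R3 => ((((1 + ‖w‖ ^ 2) ^ ((1 / 2 : ℝ) / 2) : ℝ)) : ℂ)) Set.univ := by
        refine (Complex.continuous_ofReal.comp ?_).continuousOn
        exact (by fun_prop : Continuous fun w : R3 => 1 + ‖w‖ ^ 2).rpow_const
          fun w => Or.inl (by positivity)
      exact this.continuousOn_mul hcont isOpen_univ.isLocallyClosed
    refine (Lp_eq_of_forall_schwartz F hmul fun φ => ?_).symm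
    have key := congrArg (fun T : 𝓢'(R3, ℂ) => T φ) hF
    rw [Lp.fourier_toTemperedDistribution_eq] at key
    simp only [smulLeftCLM_apply_apply, Lp.toTemperedDistribution_apply] at key
    rw [← key]
    refine integral_congr_ae (.of_forall fun x => ?_)
    simp only
    rw [SchwartzMap.smulLeftCLM_apply_apply (by fun_prop)]
    simp only [smul_eq_mul]
    ring
  have hI : Integrable (fun w : R3 => ‖w‖ * ‖(𝓕 ξ : L2R3) w‖ ^ 2) := by
    refine (integrable_norm_sq_Lp F).mono' ?_ ?_
    · exact (continuous_norm.stronglyMeasurable.mul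
        ((Lp.stronglyMeasurable (𝓕 ξ)).norm.pow 2)).aestronglyMeasurable
    · filter_upwards [hae] with w hw
      rw [← hw, norm_mul, norm_mul, norm_norm, norm_pow, norm_norm, mul_pow, Complex.norm_real,
        Real.norm_of_nonneg (by positivity), ← Real.rpow_natCast ((1 + ‖w‖ ^ 2) ^ _),
        ← Real.rpow_mul (by positivity)]
      gcongr
      norm_num
      rw [← Real.sqrt_eq_rpow]
      exact Real.le_sqrt_of_sq_le (by linarith)
  have := (hI.comp_smul (R := (2 * π)⁻¹) (by positivity)).const_mul
    ((2 * π) * (2 * π) ^ (-3 : ℝ))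
  refine this.congr (.of_forall fun p => ?_)
  simp only [norm_hat_sq, norm_smul]
  rw [Real.norm_of_nonneg (by positivity)]
  field_simp

/-! ### Gaussians and their pairings with `ξ̂` -/

theorem integrable_gaussian {b : ℝ} (hb : 0 < b) (a : R3) :
    Integrable (fun x : R3 => rexp (-b * ‖x - a‖ ^ 2)) := by
  have := GaussianFourier.integrable_cexp_neg_mul_sq_norm_add (V := R3) (b := (b : ℂ))
    (by simpa using hb) 0 0
  have h2 := this.norm
  simp only [Complex.norm_exp] at h2
  have h3 := h2.comp_sub_right a
  refine h3.congr (.of_forall fun x => ?_)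
  simp only
  congr 1
  simp [← Complex.ofReal_pow]

theorem memLp_two_gaussian {b : ℝ} (hb : 0 < b) (a : R3) :
    MemLp (fun x : R3 => rexp (-b * ‖x - a‖ ^ 2)) 2 := by
  rw [memLp_two_iff_integrable_sq (by fun_prop)]
  refine (integrable_gaussian (b := 2 * b) (by positivity) a).congr (.of_forall fun x => ?_)
  simp only
  rw [← Real.exp_nat_mul]
  congr 1
  push_cast
  ring

theorem integral_exp_inner_mul_gaussian {b : ℝ} (hb : 0 < b) (a p : R3) :
    ∫ y : R3, Complex.exp (-(inner ℝ p y : ℝ) * Complex.I) * (rexp (-b * ‖y - a‖ ^ 2) : ℝ) =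
      (((π / b) ^ (3 / 2 : ℝ) * rexp (-‖p‖ ^ 2 / (4 * b)) : ℝ) : ℂ) *
        Complex.exp (-(inner ℝ p a : ℝ) * Complex.I) := by
  rw [← integral_add_right_eq_self _ a]
  have key := GaussianFourier.integral_cexp_neg_mul_sq_norm_add (V := R3) (b := (b : ℂ))
    (by simpa using hb) (-Complex.I) p
  have e : ∀ y : R3, Complex.exp (-(inner ℝ p (y + a) : ℝ) * Complex.I) *
      (rexp (-b * ‖y + a - a‖ ^ 2) : ℝ) =
      Complex.exp (-(inner ℝ p a : ℝ) * Complex.I) *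
        Complex.exp (-b * ‖y‖ ^ 2 + -Complex.I * (inner ℝ p y : ℝ)) := by
    intro y
    rw [Complex.ofReal_exp, ← Complex.exp_add, ← Complex.exp_add, add_sub_cancel_right,
      inner_add_right]
    congr 1
    push_cast
    ring
  simp_rw [e]
  rw [integral_const_mul, key, mul_comm]
  congr 1
  rw [Complex.ofReal_mul, Complex.ofReal_cpow (by positivity), Complex.ofReal_exp]
  simp

theorem memLp_two_phase_mul_gaussian {b : ℝ} (hb : 0 < b) (a c : R3) :
    MemLp (fun y : R3 => Complex.exp ((inner ℝ a y : ℝ) * Complex.I) *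
      (rexp (-b * ‖y - c‖ ^ 2) : ℝ)) 2 := by
  refine (memLp_two_gaussian hb c).mono (by fun_prop) (.of_forall fun y => ?_)
  rw [norm_mul, Complex.norm_exp_ofReal_mul_I, one_mul, Complex.norm_real]

theorem integrable_phase_mul_gaussian {b : ℝ} (hb : 0 < b) (a c : R3) :
    Integrable (fun y : R3 => Complex.exp ((inner ℝ a y : ℝ) * Complex.I) *
      (rexp (-b * ‖y - c‖ ^ 2) : ℝ)) := by
  refine (integrable_gaussian hb c).mono (by fun_prop) (.of_forall fun y => ?_)
  rw [norm_mul, Complex.norm_exp_ofReal_mul_I, one_mul, Complex.norm_real]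

/-- Parseval against a modulated, translated Gaussian, followed by complex conjugation to free `hat
ξ` from its conjugate. The cases `c = 0` and `a = 0` are the two pairings used later. -/
theorem integral_hat_mul_phase_gaussian (ξ : L2R3) {s : ℝ} (hs : 0 < s) (a c : R3) :
    ∫ q, hat ξ q * (Complex.exp ((inner ℝ (q - a) c : ℝ) * Complex.I) *
        (rexp (-s * ‖q - a‖ ^ 2) : ℝ)) = ((2 * s) ^ (-(3 / 2) : ℝ) : ℝ) *
      ∫ y, Complex.exp (-(inner ℝ a y : ℝ) * Complex.I) *
        (ξ y * (rexp (-‖y - c‖ ^ 2 / (4 * s)) : ℝ)) := by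
  have hb : 0 < (4 * s)⁻¹ := by positivity
  have key := integral_conj_hat_mul_fourier ξ (integrable_phase_mul_gaussian hb a c)
    (memLp_two_phase_mul_gaussian hb a c)
  have e : ∀ p : R3, ∫ y, Complex.exp (-(inner ℝ p y : ℝ) * Complex.I) *
      (Complex.exp ((inner ℝ a y : ℝ) * Complex.I) * (rexp (-(4 * s)⁻¹ * ‖y - c‖ ^ 2) : ℝ)) =
      (((4 * π * s) ^ (3 / 2 : ℝ) * rexp (-s * ‖p - a‖ ^ 2) : ℝ) : ℂ) *
        Complex.exp (-(inner ℝ (p - a) c : ℝ) * Complex.I) := by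
    intro p
    have := integral_exp_inner_mul_gaussian hb c (p - a)
    have e1 : π / (4 * s)⁻¹ = 4 * π * s := by field_simp
    have e2 : -‖p - a‖ ^ 2 / (4 * (4 * s)⁻¹) = -s * ‖p - a‖ ^ 2 := by field_simp
    rw [e1, e2] at this
    rw [← this]
    refine integral_congr_ae (.of_forall fun y => ?_)
    simp only
    rw [← mul_assoc, ← Complex.exp_add, inner_sub_left]
    congr 2
    push_cast
    ring
  simp_rw [e] at key
  have key2 := congrArg conj key
  rw [map_mul, ← integral_conj, ← integral_conj, Complex.conj_ofReal] at key2
  have hc : ((2 * s) ^ (-(3 / 2) : ℝ) : ℝ) =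
      ((4 * π * s) ^ (3 / 2 : ℝ))⁻¹ * (2 * π) ^ (3 / 2 : ℝ) := by
    rw [← Real.inv_rpow (by positivity), ← Real.mul_rpow (by positivity) (by positivity),
      Real.rpow_neg (by positivity), ← Real.inv_rpow (by positivity)]
    congr 1
    field_simp
    norm_num
  have e3 : ∫ y, conj (conj (ξ y) * (Complex.exp ((inner ℝ a y : ℝ) * Complex.I) *
      (rexp (-(4 * s)⁻¹ * ‖y - c‖ ^ 2) : ℝ))) =
      ∫ y, Complex.exp (-(inner ℝ a y : ℝ) * Complex.I) *
        (ξ y * (rexp (-‖y - c‖ ^ 2 / (4 * s)) : ℝ)) := by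
    refine integral_congr_ae (.of_forall fun y => ?_)
    simp only [map_mul, Complex.conj_conj, Complex.conj_ofReal, ← Complex.exp_conj,
      Complex.conj_I]
    rw [mul_left_comm]
    congr 1
    · congr 1; ring
    · congr 3; ring
  rw [e3] at key2
  rw [hc, Complex.ofReal_mul, mul_assoc, ← key2, ← integral_const_mul]
  refine integral_congr_ae (.of_forall fun y => ?_)
  simp only [map_mul, Complex.conj_conj, Complex.conj_ofReal, ← Complex.exp_conj,
      Complex.conj_I, map_neg]
  have hne : (((4 * π * s) ^ (3 / 2 : ℝ) : ℝ) : ℂ) ≠ 0 := by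
    exact_mod_cast (by positivity : (0:ℝ) < (4 * π * s) ^ (3 / 2 : ℝ)).ne'
  push_cast at hne ⊢
  field_simp

/-- Pairing `ξ̂` with a translated Gaussian. -/
theorem integral_hat_mul_gaussian (ξ : L2R3) {s : ℝ} (hs : 0 < s) (a : R3) :
    ∫ q, hat ξ q * (rexp (-s * ‖q - a‖ ^ 2) : ℝ) = ((2 * s) ^ (-(3 / 2) : ℝ) : ℝ) *
      ∫ y, Complex.exp (-(inner ℝ a y : ℝ) * Complex.I) *
        (ξ y * (rexp (-‖y‖ ^ 2 / (4 * s)) : ℝ)) := by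
  simpa using integral_hat_mul_phase_gaussian ξ hs a 0

/-- Pairing `ξ̂` with a modulated Gaussian. -/
theorem integral_hat_mul_modulated_gaussian (ξ : L2R3) {s : ℝ} (hs : 0 < s) (c : R3) :
    ∫ p, hat ξ p * (Complex.exp ((inner ℝ p c : ℝ) * Complex.I) * (rexp (-s * ‖p‖ ^ 2) : ℝ)) =
      ((2 * s) ^ (-(3 / 2) : ℝ) : ℝ) * ∫ x, ξ x * (rexp (-‖x - c‖ ^ 2 / (4 * s)) : ℝ) := by
  simpa using integral_hat_mul_phase_gaussian ξ hs 0 c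

/-! ### Gaussian quadratic forms -/

/-- The measure-preserving shear `(x, y) ↦ (x, y - x)` makes the integrand a product. -/
theorem integrable_norm_sq_mul_gaussian {f : R3 → ℂ} (hf : MemLp f 2) {s : ℝ} (hs : 0 < s) :
    Integrable (fun z : R3 × R3 => ‖f z.1‖ ^ 2 * rexp (-s * ‖z.1 - z.2‖ ^ 2)) := by
  have h1 := ((memLp_two_iff_integrable_sq_norm hf.1).1 hf).mul_prod (integrable_gaussian hs 0)
  have h2 := (measurePreserving_prod_neg_add (volume : Measure R3)
    (volume : Measure R3)).integrable_comp_of_integrable h1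
  refine h2.congr (.of_forall fun z => ?_)
  simp only [Function.comp_apply, sub_zero]
  rw [neg_add_eq_sub, norm_sub_rev]

theorem integrable_mul_gaussian_sub {f : R3 → ℂ} (hf : MemLp f 2) {s : ℝ} (hs : 0 < s) :
    Integrable (fun z : R3 × R3 =>
      conj (f z.1) * f z.2 * (rexp (-s * ‖z.1 - z.2‖ ^ 2) : ℝ)) := by
  have h1 := integrable_norm_sq_mul_gaussian hf hs
  refine (h1.add h1.swap).mono' ?_ (.of_forall fun z => ?_)
  · refine (AEStronglyMeasurable.mul ?_ hf.1.comp_snd).mul ?_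
    · exact (Complex.continuous_conj.comp_aestronglyMeasurable hf.1).comp_fst
    · fun_prop
  · simp only [Pi.add_apply, Function.comp_apply, Prod.fst_swap, Prod.snd_swap]
    rw [norm_sub_rev z.2, ← add_mul, norm_mul, norm_mul, Complex.norm_real,
      Real.norm_of_nonneg (by positivity), RCLike.norm_conj]
    gcongr
    nlinarith [sq_nonneg (‖f z.1‖ - ‖f z.2‖), sq_nonneg (‖f z.1‖), sq_nonneg ‖f z.2‖]

theorem integrable_mul_gaussian {f : R3 → ℂ} (hf : MemLp f 2) {s : ℝ} (hs : 0 < s) (a : R3) :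
    Integrable (fun x => f x * (rexp (-s * ‖x - a‖ ^ 2) : ℝ)) :=
  hf.integrable_mul (memLp_two_gaussian hs a).ofReal

theorem memLp_mul_gaussian {f : R3 → ℂ} (hf : MemLp f 2) {s : ℝ} (hs : 0 < s) (a : R3) :
    MemLp (fun x => f x * (rexp (-s * ‖x - a‖ ^ 2) : ℝ)) 2 := by
  refine hf.mono (hf.1.mul (by fun_prop)) (.of_forall fun x => ?_)
  rw [norm_mul, Complex.norm_real, Real.norm_of_nonneg (by positivity)]
  refine mul_le_of_le_one_right (norm_nonneg _) ?_
  rw [Real.exp_le_one_iff]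
  nlinarith [sq_nonneg ‖x - a‖]

theorem conj_mul_self_mul_ofReal (z : ℂ) (r : ℝ) :
    conj z * (z * (r : ℂ)) = ((‖z‖ ^ 2 * r : ℝ) : ℂ) := by
  rw [← mul_assoc, mul_comm (conj z), Complex.mul_conj, Complex.normSq_eq_norm_sq]
  push_cast
  rfl

/-- The inner integral in `q` is the Fourier transform at `p` of `ξ` times a Gaussian; Parseval in
`p` then leaves `|ξ|²` times that Gaussian. -/
theorem integral_hat_gaussian_sub (ξ : L2R3) {s : ℝ} (hs : 0 < s) :
    ∫ z : R3 × R3, conj (hat ξ z.1) * hat ξ z.2 * (rexp (-s * ‖z.1 - z.2‖ ^ 2) : ℝ) =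
      (((π / s) ^ (3 / 2 : ℝ) * ∫ x, ‖ξ x‖ ^ 2 * rexp (-‖x‖ ^ 2 / (4 * s)) : ℝ) : ℂ) := by
  have hI := integrable_mul_gaussian_sub (memLp_hat ξ) hs
  rw [Measure.volume_eq_prod] at hI ⊢
  rw [integral_prod _ hI]
  have hs' : 0 < (4 * s)⁻¹ := by positivity
  have e : ∀ y, -‖y‖ ^ 2 / (4 * s) = -(4 * s)⁻¹ * ‖y - (0 : R3)‖ ^ 2 := by
    intro y; rw [sub_zero]; ring
  simp_rw [e]
  have e1 : ∀ p : R3, ∫ q, conj (hat ξ p) * hat ξ q * (rexp (-s * ‖p - q‖ ^ 2) : ℝ) =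
      ((2 * s) ^ (-(3 / 2) : ℝ) : ℝ) * (conj (hat ξ p) *
        ∫ y, Complex.exp (-(inner ℝ p y : ℝ) * Complex.I) *
        (ξ y * (rexp (-(4 * s)⁻¹ * ‖y - (0 : R3)‖ ^ 2) : ℝ))) := by
    intro p
    simp_rw [mul_assoc, norm_sub_rev p]
    rw [integral_const_mul, integral_hat_mul_gaussian ξ hs p, mul_left_comm]
    simp_rw [e]
  simp_rw [e1]
  rw [integral_const_mul, integral_conj_hat_mul_fourier ξ
    (integrable_mul_gaussian (Lp.memLp ξ) hs' 0) (memLp_mul_gaussian (Lp.memLp ξ) hs' 0)]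
  simp_rw [conj_mul_self_mul_ofReal]
  rw [integral_complex_ofReal, ← mul_assoc, Complex.ofReal_mul]
  congr 1
  rw [← Complex.ofReal_mul, Real.rpow_neg (by positivity), ← Real.inv_rpow (by positivity),
    ← Real.mul_rpow (by positivity) (by positivity)]
  congr 2
  field_simp

theorem integral_gaussian_sub (ξ : L2R3) {s : ℝ} (hs : 0 < s) :
    ∫ z : R3 × R3, conj (ξ z.1) * ξ z.2 * (rexp (-s * ‖z.1 - z.2‖ ^ 2) : ℝ) =
      (((π / s) ^ (3 / 2 : ℝ) * ∫ p, ‖hat ξ p‖ ^ 2 * rexp (-‖p‖ ^ 2 / (4 * s)) : ℝ) : ℂ) := by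
  have hI := integrable_mul_gaussian_sub (Lp.memLp ξ) hs
  rw [Measure.volume_eq_prod] at hI ⊢
  rw [integral_prod _ hI]
  have hs' : 0 < (4 * s)⁻¹ := by positivity
  have e : ∀ y, -‖y‖ ^ 2 / (4 * s) = -(4 * s)⁻¹ * ‖y - (0 : R3)‖ ^ 2 := by
    intro y; rw [sub_zero]; ring
  simp_rw [e]
  have hpos : (0 : ℝ) < (2 * (4 * s)⁻¹) ^ (3 / 2 : ℝ) := by positivity
  have e1 : ∀ x : R3, ∫ y, conj (ξ x) * ξ y * (rexp (-s * ‖x - y‖ ^ 2) : ℝ) =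
      ((2 * (4 * s)⁻¹) ^ (3 / 2 : ℝ) : ℝ) * (conj (ξ x) *
        ∫ p, Complex.exp ((inner ℝ p x : ℝ) * Complex.I) *
        (hat ξ p * (rexp (-(4 * s)⁻¹ * ‖p - (0 : R3)‖ ^ 2) : ℝ))) := by
    intro x
    simp_rw [mul_assoc, norm_sub_rev x]
    rw [integral_const_mul, mul_left_comm]
    congr 1
    have := integral_hat_mul_modulated_gaussian ξ hs' x
    simp_rw [sub_zero, mul_left_comm (Complex.exp _)]
    rw [this, Real.rpow_neg (by positivity), Complex.ofReal_inv, ← mul_assoc, mul_inv_cancel₀,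
      one_mul]
    · refine integral_congr_ae (.of_forall fun y => ?_)
      simp only
      congr 3
      field_simp
    · exact_mod_cast hpos.ne'
  simp_rw [e1]
  rw [integral_const_mul, integral_conj_mul_fourierInv_hat ξ
    (integrable_mul_gaussian (memLp_hat ξ) hs' 0) (memLp_mul_gaussian (memLp_hat ξ) hs' 0)]
  simp_rw [conj_mul_self_mul_ofReal]
  rw [integral_complex_ofReal, ← mul_assoc, Complex.ofReal_mul]
  congr 1
  rw [← Complex.ofReal_mul, ← Real.mul_rpow (by positivity) (by positivity)]
  congr 2
  field_simp
  norm_num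

/-- The quadratic form `|x|² + |y|² + x·y`. -/
noncomputable def offForm (z : R3 × R3) : ℝ := ‖z.1‖ ^ 2 + ‖z.2‖ ^ 2 + inner ℝ z.1 z.2

theorem continuous_offForm : Continuous offForm := by
  unfold offForm; fun_prop

/-- Here `Q = (|x|² + |y|²)/2 + |x + y|²/2`, while the next bound uses `Q = |x - y|²/4 + 3|x +
y|²/4`. The first feeds the Schur estimates, the second dominates `e^{-sQ}` by a Gaussian in `x -
y`. -/
theorem half_sq_le_offForm (z : R3 × R3) : (‖z.1‖ ^ 2 + ‖z.2‖ ^ 2) / 2 ≤ offForm z := by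
  unfold offForm
  have := norm_add_sq_real z.1 z.2
  nlinarith [sq_nonneg ‖z.1 + z.2‖]

theorem quarter_norm_sub_sq_le_offForm (z : R3 × R3) : ‖z.1 - z.2‖ ^ 2 / 4 ≤ offForm z := by
  unfold offForm
  have := norm_add_sq_real z.1 z.2
  have := norm_sub_sq_real z.1 z.2
  nlinarith [sq_nonneg ‖z.1 + z.2‖, sq_nonneg ‖z.1‖, sq_nonneg ‖z.2‖]

theorem integrable_mul_exp_offForm {f : R3 → ℂ} (hf : MemLp f 2) {s : ℝ} (hs : 0 < s) :
    Integrable (fun z : R3 × R3 => conj (f z.1) * f z.2 * (rexp (-s * offForm z) : ℝ)) := by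
  refine (integrable_mul_gaussian_sub hf (s := s / 4) (by positivity)).mono ?_
    (.of_forall fun z => ?_)
  · refine (AEStronglyMeasurable.mul ?_ hf.1.comp_snd).mul ?_
    · exact (Complex.continuous_conj.comp_aestronglyMeasurable hf.1).comp_fst
    · have := continuous_offForm
      exact Continuous.aestronglyMeasurable (by fun_prop)
  · rw [norm_mul, norm_mul (_ * _), Complex.norm_real, Complex.norm_real,
      Real.norm_of_nonneg (by positivity), Real.norm_of_nonneg (by positivity)]
    refine mul_le_mul_of_nonneg_left (Real.exp_le_exp.2 ?_) (norm_nonneg _)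
    nlinarith [quarter_norm_sub_sq_le_offForm z]

/-- The variables are transformed one at a time. From `Q(p, q) = ¾|p|² + |q + p/2|²`, the
`q`-integral produces a phase `e^{i p·y/2}` and `e^{-|y|²/(4t)}`; the `p`-integral then produces
`e^{-|x + y/2|²/(3t)}`, and the exponents recombine into `-Q(x, y)/(3t)`. Inverting the quadratic
form flips the sign of its cross term, and the conjugate on one factor flips it back. -/
theorem integral_hat_exp_offForm (ξ : L2R3) {t : ℝ} (ht : 0 < t) :
    ∫ z : R3 × R3, conj (hat ξ z.1) * hat ξ z.2 * (rexp (-t * offForm z) : ℝ) =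
      ((3 * t ^ 2) ^ (-(3 / 2) : ℝ) : ℝ) *
        ∫ z : R3 × R3, conj (ξ z.1) * ξ z.2 * (rexp (-(3 * t)⁻¹ * offForm z) : ℝ) := by
  have hI := integrable_mul_exp_offForm (memLp_hat ξ) ht
  have hJ := integrable_mul_exp_offForm (Lp.memLp ξ) (s := (3 * t)⁻¹) (by positivity)
  rw [Measure.volume_eq_prod] at hI hJ ⊢
  -- The position side is sliced with `y` outermost, the order reached after exchanging `p` and `y`
  -- in the half-transformed integrand `H`.
  rw [integral_prod _ hI, integral_prod_symm _ hJ]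
  have h3 : (0 : ℝ) < 3 / 4 * t := by positivity
  have h4 : (0 : ℝ) < (4 * t)⁻¹ := by positivity
  set c₁ : ℝ := (2 * t) ^ (-(3 / 2) : ℝ) with hc₁
  set c₂ : ℝ := (2 * (3 / 4 * t)) ^ (-(3 / 2) : ℝ) with hc₂
  let H : R3 → R3 → ℂ := fun p y =>
    (conj (hat ξ p) * (rexp (-(3 / 4 * t) * ‖p‖ ^ 2) : ℝ)) *
      (Complex.exp ((inner ℝ p y / 2 : ℝ) * Complex.I) *
        (ξ y * (rexp (-(4 * t)⁻¹ * ‖y‖ ^ 2) : ℝ)))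
  have e1 : ∀ p : R3, ∫ q, conj (hat ξ p) * hat ξ q * (rexp (-t * offForm (p, q)) : ℝ) =
      c₁ * ∫ y, H p y := by
    intro p
    have key := integral_hat_mul_gaussian ξ ht (-((1 / 2 : ℝ) • p))
    rw [integral_const_mul, mul_left_comm]
    have e2 : ∫ y, Complex.exp ((inner ℝ p y / 2 : ℝ) * Complex.I) *
        (ξ y * (rexp (-(4 * t)⁻¹ * ‖y‖ ^ 2) : ℝ)) =
        ∫ y, Complex.exp (-(inner ℝ (-((1 / 2 : ℝ) • p)) y : ℝ) * Complex.I) *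
        (ξ y * (rexp (-‖y‖ ^ 2 / (4 * t)) : ℝ)) := by
      refine integral_congr_ae (.of_forall fun y => ?_)
      simp only [inner_neg_left, real_inner_smul_left]
      congr 3
      · push_cast; ring
      · congr 1; ring
    rw [e2, ← key, ← integral_const_mul]
    refine integral_congr_ae (.of_forall fun q => ?_)
    simp only [offForm]
    have : -t * (‖p‖ ^ 2 + ‖q‖ ^ 2 + inner ℝ p q) =
        -(3 / 4 * t) * ‖p‖ ^ 2 + -t * ‖q - -((1 / 2 : ℝ) • p)‖ ^ 2 := by
      rw [sub_neg_eq_add, norm_add_sq_real, real_inner_smul_right, norm_smul, real_inner_comm]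
      norm_num
      ring
    rw [this, Real.exp_add]
    push_cast
    ring
  have e3 : ∀ y : R3, ∫ p, H p y =
      c₂ * ∫ x, conj (ξ x) * ξ y * (rexp (-(3 * t)⁻¹ * offForm (x, y)) : ℝ) := by
    intro y
    have key := congrArg conj
      (integral_hat_mul_modulated_gaussian ξ h3 (-((1 / 2 : ℝ) • y)))
    rw [map_mul, ← integral_conj, ← integral_conj, Complex.conj_ofReal] at key
    have e4 : ∫ p, H p y = (∫ p, conj (hat ξ p * (Complex.exp
        ((inner ℝ p (-((1 / 2 : ℝ) • y)) : ℝ) * Complex.I) *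
          (rexp (-(3 / 4 * t) * ‖p‖ ^ 2) : ℝ)))) *
        (ξ y * (rexp (-(4 * t)⁻¹ * ‖y‖ ^ 2) : ℝ)) := by
      rw [← integral_mul_const]
      refine integral_congr_ae (.of_forall fun p => ?_)
      simp only [H, map_mul, Complex.conj_ofReal, ← Complex.exp_conj, Complex.conj_I,
        inner_neg_right, real_inner_smul_right]
      have : ((inner ℝ p y / 2 : ℝ) : ℂ) * Complex.I =
          ((-(1 / 2 * inner ℝ p y) : ℝ) : ℂ) * -Complex.I := by
        push_cast; ring
      rw [this]
      ring
    rw [e4, key, mul_assoc, ← integral_mul_const]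
    congr 1
    refine integral_congr_ae (.of_forall fun x => ?_)
    simp only [map_mul, Complex.conj_ofReal, offForm]
    have : -(3 * t)⁻¹ * (‖x‖ ^ 2 + ‖y‖ ^ 2 + inner ℝ x y) =
        -‖x - -((1 / 2 : ℝ) • y)‖ ^ 2 / (4 * (3 / 4 * t)) + -(4 * t)⁻¹ * ‖y‖ ^ 2 := by
      rw [sub_neg_eq_add, norm_add_sq_real, real_inner_smul_right, norm_smul]
      norm_num
      field_simp
      ring
    rw [this, Real.exp_add]
    push_cast
    ring
  have hH : Integrable (Function.uncurry H) ((volume : Measure R3).prod volume) := by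
    have h1 := integrable_mul_gaussian (memLp_hat ξ) h3 0
    have h2 := integrable_mul_gaussian (Lp.memLp ξ) h4 0
    refine (h1.mul_prod h2).mono ?_ (.of_forall fun z => ?_)
    · refine AEStronglyMeasurable.mul (AEStronglyMeasurable.mul ?_ (by fun_prop))
        (AEStronglyMeasurable.mul (by fun_prop) (AEStronglyMeasurable.mul ?_ (by fun_prop)))
      · exact (Complex.continuous_conj.comp_aestronglyMeasurable (memLp_hat ξ).1).comp_fst
      · exact (Lp.aestronglyMeasurable ξ).comp_snd
    · simp only [Function.uncurry, H, norm_mul, Complex.norm_exp_ofReal_mul_I, one_mul, sub_zero,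
        RCLike.norm_conj]
      exact le_rfl
  simp_rw [e1]
  rw [integral_const_mul, integral_integral_swap hH]
  simp_rw [e3]
  rw [integral_const_mul, ← mul_assoc, ← Complex.ofReal_mul]
  congr 2
  rw [hc₁, hc₂, ← Real.mul_rpow (by positivity) (by positivity)]
  congr 1
  ring

/-! ### One-dimensional integrals -/

theorem integral_exp_neg_mul_Ioi_zero {c : ℝ} (hc : 0 < c) :
    ∫ t in Set.Ioi (0 : ℝ), rexp (-t * c) = c⁻¹ := by
  have := Real.integral_rpow_mul_exp_neg_mul_Ioi one_pos hc
  simpa [mul_comm] using this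

theorem integrableOn_exp_neg_mul_Ioi_zero {c : ℝ} (hc : 0 < c) :
    IntegrableOn (fun t => rexp (-t * c)) (Set.Ioi (0 : ℝ)) :=
  -- The Bochner integral of a non-integrable function is `0`, so a nonzero value certifies
  -- integrability.
  .of_integral_ne_zero (by rw [integral_exp_neg_mul_Ioi_zero hc]; positivity)

/-- The substitution `t ↦ t⁻¹` reduces this to `Γ(2) = 1`. -/
theorem integral_inv_cube_mul_exp {b : ℝ} (hb : 0 < b) :
    ∫ t in Set.Ioi (0 : ℝ), (t ^ 3)⁻¹ * rexp (-b / t) = (b ^ 2)⁻¹ := by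
  have h1 := Real.integral_rpow_mul_exp_neg_mul_Ioi two_pos hb
  rw [← integral_comp_rpow_Ioi _ (neg_ne_zero.2 one_ne_zero)] at h1
  have h2 : (1 / b) ^ (2 : ℝ) * Gamma 2 = (b ^ 2)⁻¹ := by
    rw [Real.Gamma_two]
    norm_num
  rw [← h2, ← h1]
  refine setIntegral_congr_fun measurableSet_Ioi fun t (ht : 0 < t) => ?_
  simp only [smul_eq_mul]
  rw [Real.rpow_neg_one, abs_neg, abs_one, one_mul, ← mul_assoc]
  congr 1
  · rw [Real.inv_rpow ht.le, ← Real.rpow_neg ht.le, ← Real.rpow_add ht]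
    norm_num
  · congr 1; field_simp

theorem integrableOn_inv_cube_mul_exp {b : ℝ} (hb : 0 < b) :
    IntegrableOn (fun t => (t ^ 3)⁻¹ * rexp (-b / t)) (Set.Ioi (0 : ℝ)) :=
  .of_integral_ne_zero (by rw [integral_inv_cube_mul_exp hb]; positivity)

theorem integrableOn_inv_cube_mul_exp_add {a b : ℝ} (ha : 0 ≤ a) (hb : 0 < b) :
    IntegrableOn (fun t => (t ^ 3)⁻¹ * rexp (-a * t + -b / t)) (Set.Ioi (0 : ℝ)) := by
  refine (integrableOn_inv_cube_mul_exp hb).mono' ?_ ?_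
  · exact Measurable.aestronglyMeasurable (by fun_prop)
  · filter_upwards [ae_restrict_mem measurableSet_Ioi] with t (ht : 0 < t)
    rw [Real.norm_of_nonneg (by positivity)]
    gcongr
    nlinarith

/-- Substituting `t = √(b/a) e^u` balances the exponent into `-2√(ab) cosh u` and leaves the factor
`e^{-2u}`. Averaging over `u ↦ -u` replaces that factor by `cosh 2u`. -/
theorem integral_inv_cube_mul_exp_add {a b : ℝ} (ha : 0 < a) (hb : 0 < b) :
    ∫ t in Set.Ioi (0 : ℝ), (t ^ 3)⁻¹ * rexp (-a * t + -b / t) =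
      2 * (a / b) * macdonaldK 2 (2 * √(a * b)) := by
  set r : ℝ := √(b / a) with hr
  have hr0 : 0 < r := by positivity
  have har : a * r = √(a * b) := by
    rw [hr, Real.sqrt_div hb.le, Real.sqrt_mul ha.le]
    have := Real.mul_self_sqrt ha.le
    have := (Real.sqrt_pos.2 ha).ne'
    field_simp
    nlinarith
  have hbr : b / r = √(a * b) := by
    rw [hr, Real.sqrt_div hb.le, Real.sqrt_mul ha.le]
    have := Real.mul_self_sqrt hb.le
    have := (Real.sqrt_pos.2 ha).ne'
    have := (Real.sqrt_pos.2 hb).ne'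
    field_simp
    nlinarith
  have hr2 : r ^ 2 = b / a := Real.sq_sqrt (by positivity)
  have himg : (fun u : ℝ => r * rexp u) '' Set.univ = Set.Ioi 0 := by
    ext t
    simp only [Set.image_univ, Set.mem_range, Set.mem_Ioi]
    constructor
    · rintro ⟨u, rfl⟩; positivity
    · intro ht
      exact ⟨Real.log (t / r), by rw [Real.exp_log (by positivity)]; field_simp⟩
  have hderiv : ∀ u ∈ (Set.univ : Set ℝ),
      HasDerivWithinAt (fun u : ℝ => r * rexp u) (r * rexp u) Set.univ u :=
    fun u _ => ((Real.hasDerivAt_exp u).const_mul r).hasDerivWithinAt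
  have hinj : Set.InjOn (fun u : ℝ => r * rexp u) Set.univ := by
    intro u _ v _ h
    exact Real.exp_injective (mul_left_cancel₀ hr0.ne' h)
  set F : ℝ → ℝ := fun u => a / b * (rexp (-(2 * u)) * rexp (-(2 * √(a * b)) * Real.cosh u))
    with hF
  have hG : ∀ u : ℝ, |r * rexp u| • (((r * rexp u) ^ 3)⁻¹ *
      rexp (-a * (r * rexp u) + -b / (r * rexp u))) = F u := by
    intro u
    rw [abs_of_pos (by positivity), smul_eq_mul, ← mul_assoc, hF]
    have e1 : -a * (r * rexp u) + -b / (r * rexp u) = -(2 * √(a * b)) * Real.cosh u := by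
      have : -b / (r * rexp u) = -(b / r) * rexp (-u) := by
        rw [Real.exp_neg]; field_simp
      rw [this, hbr, ← mul_assoc, neg_mul, har, Real.cosh_eq]
      ring
    have e2 : r * rexp u * ((r * rexp u) ^ 3)⁻¹ = a / b * rexp (-(2 * u)) := by
      have : a / b = (r ^ 2)⁻¹ := by rw [hr2, inv_div]
      rw [this, Real.exp_neg, two_mul, Real.exp_add]
      field_simp
    rw [e1, e2, mul_assoc]
  have hint : Integrable F := by
    have := integrableOn_inv_cube_mul_exp_add ha.le hb
    rw [← himg, integrableOn_image_iff_integrableOn_abs_deriv_smul MeasurableSet.univ hderiv hinj,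
      integrableOn_univ] at this
    exact this.congr (.of_forall hG)
  rw [← himg, integral_image_eq_integral_abs_deriv_smul MeasurableSet.univ hderiv hinj,
    setIntegral_univ]
  simp_rw [hG]
  have hsym : ∫ u, F u = ∫ u, (F u + F (-u)) / 2 := by
    rw [integral_div, integral_add hint hint.comp_neg, integral_neg_eq_self]
    ring
  have hcosh : ∀ u, (F u + F (-u)) / 2 = a / b *
      (rexp (-(2 * √(a * b)) * Real.cosh |u|) * Real.cosh (2 * |u|)) := by
    intro u
    simp only [hF]
    have : Real.cosh (2 * |u|) = Real.cosh (2 * u) := by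
      rw [← Real.cosh_abs (2 * u), abs_mul, abs_two]
    rw [this, Real.cosh_abs, Real.cosh_neg, Real.cosh_eq (2 * u), mul_neg, neg_neg]
    ring
  rw [hsym]
  simp_rw [hcosh]
  rw [integral_comp_abs (f := fun v => a / b *
    (rexp (-(2 * √(a * b)) * Real.cosh v) * Real.cosh (2 * v))), integral_const_mul, macdonaldK]
  ring

theorem integral_rpow_mul_exp_neg_sq_div {r : ℝ} (hr : 0 < r) :
    ∫ t in Set.Ioi (0 : ℝ), (π / t) ^ (3 / 2 : ℝ) * rexp (-r ^ 2 / (4 * t)) =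
      2 * π ^ 2 / r := by
  have h1 := Real.integral_rpow_mul_exp_neg_mul_Ioi (a := 1 / 2) (r := r ^ 2 / 4)
    (by norm_num) (by positivity)
  rw [← integral_comp_rpow_Ioi _ (neg_ne_zero.2 one_ne_zero)] at h1
  have h2 : 2 * π ^ 2 / r = π ^ (3 / 2 : ℝ) * ((1 / (r ^ 2 / 4)) ^ (1 / 2 : ℝ) * Gamma (1 / 2)) := by
    rw [Real.Gamma_one_half_eq, Real.sqrt_eq_rpow, mul_left_comm, ← Real.rpow_add pi_pos,
      ← Real.sqrt_eq_rpow]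
    have : 1 / (r ^ 2 / 4) = (2 / r) ^ 2 := by field_simp; norm_num
    rw [this, Real.sqrt_sq (by positivity)]
    norm_num
    ring
  rw [h2, ← h1, ← integral_const_mul]
  refine setIntegral_congr_fun measurableSet_Ioi fun t (ht : 0 < t) => ?_
  simp only [smul_eq_mul]
  rw [Real.rpow_neg_one, abs_neg, abs_one, one_mul, Real.div_rpow pi_pos.le ht.le,
    div_eq_mul_inv, mul_assoc]
  congr 1
  rw [← mul_assoc]
  congr 1
  · rw [Real.inv_rpow ht.le, ← Real.rpow_neg ht.le, ← Real.rpow_neg ht.le, ← Real.rpow_add ht]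
    norm_num
  · congr 1; field_simp

/-- Since `t⁻¹ e^{-lt} (1 - e^{-at}) = ∫_l^{a+l} e^{-ct} dc`, Tonelli reduces the claim to `Γ(1/2)`
in `t` and then to the integral of `√π c^{-1/2}`. -/
theorem lintegral_subordination_sqrt {a l : ℝ} (ha : 0 ≤ a) (hl : 0 < l) :
    ∫⁻ t in Set.Ioi (0 : ℝ), ENNReal.ofReal
        (t ^ (-(3 / 2) : ℝ) * rexp (-l * t) * (1 - rexp (-a * t))) =
      ENNReal.ofReal (2 * √π * (√(a + l) - √l)) := by
  have hinner : ∀ t ∈ Set.Ioi (0 : ℝ), ENNReal.ofReal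
      (t ^ (-(3 / 2) : ℝ) * rexp (-l * t) * (1 - rexp (-a * t))) =
      ∫⁻ c in Set.Ioc l (a + l), ENNReal.ofReal (t ^ (1 / 2 - 1 : ℝ) * rexp (-(c * t))) := by
    intro t (ht : 0 < t)
    rw [← ofReal_integral_eq_lintegral_ofReal]
    · congr 1
      rw [← intervalIntegral.integral_of_le (by linarith), intervalIntegral.integral_const_mul]
      have hd : ∀ c ∈ Set.uIcc l (a + l),
          HasDerivAt (fun c => -(t⁻¹ * rexp (-(c * t)))) (rexp (-(c * t))) c := by
        intro c _
        have := (((hasDerivAt_id c).mul_const t).neg.exp.const_mul t⁻¹).neg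
        refine this.congr_deriv ?_
        simp only [id, Pi.neg_apply]
        field_simp
      rw [intervalIntegral.integral_eq_sub_of_hasDerivAt hd
        (Continuous.intervalIntegrable (by fun_prop) _ _)]
      have : t ^ (-(3 / 2) : ℝ) = t ^ (1 / 2 - 1 : ℝ) * t⁻¹ := by
        rw [← Real.rpow_neg_one, ← Real.rpow_add ht]; norm_num
      have h2 : rexp (-((a + l) * t)) = rexp (-l * t) * rexp (-a * t) := by
        rw [← Real.exp_add]; congr 1; ring
      rw [this, h2, neg_mul l]
      ring
    · exact (Continuous.integrableOn_Icc (by fun_prop)).mono_set Set.Ioc_subset_Icc_self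
    · exact .of_forall fun c => by positivity
  rw [setLIntegral_congr_fun measurableSet_Ioi hinner, lintegral_lintegral_swap]
  · have houter : ∀ c ∈ Set.Ioc l (a + l), ∫⁻ t in Set.Ioi (0 : ℝ),
        ENNReal.ofReal (t ^ (1 / 2 - 1 : ℝ) * rexp (-(c * t))) =
        ENNReal.ofReal (√π * c ^ (-(1 / 2) : ℝ)) := by
      intro c hc
      have hc0 : 0 < c := hl.trans hc.1
      have h1 := Real.integral_rpow_mul_exp_neg_mul_Ioi (a := 1 / 2) (r := c) (by norm_num) hc0
      rw [← ofReal_integral_eq_lintegral_ofReal, h1, Real.Gamma_one_half_eq, one_div,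
        Real.inv_rpow hc0.le, Real.rpow_neg hc0.le, mul_comm]
      · refine .of_integral_ne_zero ?_
        rw [h1, Real.Gamma_one_half_eq]
        positivity
      · filter_upwards [ae_restrict_mem measurableSet_Ioi] with t (ht : 0 < t)
        positivity
    rw [setLIntegral_congr_fun measurableSet_Ioc houter, ← ofReal_integral_eq_lintegral_ofReal]
    · rw [← intervalIntegral.integral_of_le (by linarith), intervalIntegral.integral_const_mul,
        integral_rpow (Or.inl (by norm_num)), Real.sqrt_eq_rpow (a + l), Real.sqrt_eq_rpow l]
      congr 1
      norm_num
      ring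
    · have : ContinuousOn (fun c : ℝ => √π * c ^ (-(1 / 2) : ℝ)) (Set.Icc l (a + l)) := by
        refine continuousOn_const.mul (continuousOn_id.rpow_const fun c hc => Or.inl ?_)
        exact (hl.trans_le hc.1).ne'
      exact this.integrableOn_Icc.mono_set Set.Ioc_subset_Icc_self
    · filter_upwards [ae_restrict_mem measurableSet_Ioc] with c hc
      have : 0 < c := hl.trans hc.1
      positivity
  · refine Measurable.aemeasurable ?_
    unfold Function.uncurry
    fun_prop

/-! ### Absolute convergence in momentum space -/

theorem ofReal_two_mul (x : ℝ) : ENNReal.ofReal (2 * x) = 2 * ENNReal.ofReal x := by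
  rw [ENNReal.ofReal_mul (by norm_num), ENNReal.ofReal_ofNat]

theorem exists_lintegral_inv_norm_sq_mul_le : ∃ C : ℝ, 0 ≤ C ∧ ∀ A : ℝ, 0 < A →
    ∫⁻ q : R3, ENNReal.ofReal ((‖q‖ ^ 2)⁻¹ * (A ^ 2 + ‖q‖ ^ 2)⁻¹) ≤ ENNReal.ofReal (C / A) := by
  -- In polar coordinates `r²` cancels the weight, leaving the sphere area (three times the ball
  -- volume) times `∫₀^∞ dr/(A² + r²) = π/(2A)`.
  refine ⟨3 * volume.real (Metric.ball (0 : R3) 1) * (π / 2), by positivity, fun A hA => ?_⟩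
  have hrad : Set.EqOn (fun y : ℝ => y ^ (Module.finrank ℝ R3 - 1) • ((y ^ 2)⁻¹ * (A ^ 2 + y ^ 2)⁻¹))
      (fun y => (A ^ 2)⁻¹ * (1 + (A⁻¹ * y) ^ 2)⁻¹) (Set.Ioi 0) := by
    intro y (hy : 0 < y)
    simp only [finrank_euclideanSpace, Fintype.card_fin, smul_eq_mul]
    norm_num
    field_simp
  have hI : IntegrableOn (fun y : ℝ => (A ^ 2)⁻¹ * (1 + (A⁻¹ * y) ^ 2)⁻¹) (Set.Ioi 0) :=
    ((integrable_inv_one_add_sq.comp_mul_left' (inv_ne_zero hA.ne')).const_mul _).integrableOn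
  have hint : Integrable (fun q : R3 => (‖q‖ ^ 2)⁻¹ * (A ^ 2 + ‖q‖ ^ 2)⁻¹) :=
    (integrable_fun_norm_addHaar volume (f := fun y => (y ^ 2)⁻¹ * (A ^ 2 + y ^ 2)⁻¹)).2
      (hI.congr_fun hrad.symm measurableSet_Ioi)
  rw [← ofReal_integral_eq_lintegral_ofReal hint (.of_forall fun q => by positivity),
    integral_fun_norm_addHaar volume (fun y => (y ^ 2)⁻¹ * (A ^ 2 + y ^ 2)⁻¹),
    setIntegral_congr_fun measurableSet_Ioi hrad, integral_const_mul,
    integral_comp_mul_left_Ioi (fun y => (1 + y ^ 2)⁻¹) 0 (inv_pos.2 hA), mul_zero,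
    integral_Ioi_inv_one_add_sq]
  refine le_of_eq (congrArg _ ?_)
  simp only [finrank_euclideanSpace, Fintype.card_fin, smul_eq_mul, nsmul_eq_mul, Real.arctan_zero]
  push_cast
  field_simp
  simp

theorem ae_ne_zero : ∀ᵐ p : R3, p ≠ 0 := by
  simp [ae_iff]

theorem ae_fst_ne_zero : ∀ᵐ z : R3 × R3, z.1 ≠ 0 :=
  Measure.quasiMeasurePreserving_fst.ae ae_ne_zero

/-- Schur's test with the weight `|p|²`. -/
theorem integrable_of_schur_weight {f : R3 → ℂ} (hf : AEStronglyMeasurable f)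
    {k : R3 × R3 → ℝ} (hk : Measurable k) (hk0 : ∀ z, 0 ≤ k z) (hsymm : ∀ z, k z.swap = k z)
    {w : R3 → ℝ}
    (hw : ∀ p ≠ 0, ∫⁻ q, ENNReal.ofReal ((‖q‖ ^ 2)⁻¹ * k (p, q)) ≤ ENNReal.ofReal (w p))
    (hfw : Integrable (fun p => ‖p‖ ^ 2 * w p * ‖f p‖ ^ 2)) :
    Integrable (fun z : R3 × R3 => conj (f z.1) * f z.2 * (k z : ℂ)) := by
  -- By AM-GM on `|p||f(p)|/|q|` and `|q||f(q)|/|p|`, this function plus its swap dominates the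
  -- integrand; `hw` controls its `q`-integral.
  set F : R3 × R3 → ℝ := fun z => (‖z.1‖ ^ 2 * ‖f z.1‖ ^ 2) * ((‖z.2‖ ^ 2)⁻¹ * k z) with hF
  have hFm : AEStronglyMeasurable F := by
    refine AEStronglyMeasurable.mul (AEStronglyMeasurable.mul (by fun_prop) ?_) ?_
    · exact hf.comp_fst.norm.pow 2
    · exact Measurable.aestronglyMeasurable (by fun_prop)
  have hFi : Integrable F := by
    refine ⟨hFm, ?_⟩
    have hF0 : ∀ z, 0 ≤ F z := fun z => by
      have := hk0 z
      simp only [hF]; positivity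
    rw [hasFiniteIntegral_iff_ofReal (.of_forall hF0), Measure.volume_eq_prod, lintegral_prod _ hFm.aemeasurable.ennreal_ofReal]
    refine lt_of_le_of_lt (lintegral_mono_ae ?_) hfw.lintegral_lt_top
    filter_upwards [ae_ne_zero] with p hp
    simp only [hF]
    have h1 : ∀ q, ENNReal.ofReal (‖p‖ ^ 2 * ‖f p‖ ^ 2 * ((‖q‖ ^ 2)⁻¹ * k (p, q))) =
        ENNReal.ofReal (‖p‖ ^ 2 * ‖f p‖ ^ 2) * ENNReal.ofReal ((‖q‖ ^ 2)⁻¹ * k (p, q)) :=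
      fun q => ENNReal.ofReal_mul (by positivity)
    simp_rw [h1]
    rw [lintegral_const_mul _ (by fun_prop)]
    calc _ ≤ ENNReal.ofReal (‖p‖ ^ 2 * ‖f p‖ ^ 2) * ENNReal.ofReal (w p) := by
          gcongr; exact hw p hp
      _ = _ := by
          rw [← ENNReal.ofReal_mul (by positivity)]
          congr 1; ring
  have hne2 : ∀ᵐ z : R3 × R3, z.2 ≠ 0 := Measure.quasiMeasurePreserving_snd.ae ae_ne_zero
  refine (hFi.add hFi.swap).mono' ?_ ?_
  · refine AEStronglyMeasurable.mul (AEStronglyMeasurable.mul ?_ hf.comp_snd) ?_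
    · exact (Complex.continuous_conj.comp_aestronglyMeasurable hf).comp_fst
    · exact Measurable.aestronglyMeasurable (by fun_prop)
  · filter_upwards [ae_fst_ne_zero, hne2] with z h1 h2
    have hp : 0 < ‖z.1‖ := norm_pos_iff.2 h1
    have hq : 0 < ‖z.2‖ := norm_pos_iff.2 h2
    simp only [hF, Pi.add_apply, Function.comp_apply, Prod.fst_swap, Prod.snd_swap, hsymm,
      norm_mul, RCLike.norm_conj, Complex.norm_real, Real.norm_of_nonneg (hk0 z)]
    rw [← mul_assoc, ← mul_assoc, ← add_mul]
    refine mul_le_mul_of_nonneg_right ?_ (hk0 z)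
    have key := two_mul_le_add_sq (‖z.1‖ * ‖f z.1‖ / ‖z.2‖) (‖z.2‖ * ‖f z.2‖ / ‖z.1‖)
    have e1 : 2 * (‖z.1‖ * ‖f z.1‖ / ‖z.2‖) * (‖z.2‖ * ‖f z.2‖ / ‖z.1‖) =
        2 * (‖f z.1‖ * ‖f z.2‖) := by field_simp
    have e2 : (‖z.1‖ * ‖f z.1‖ / ‖z.2‖) ^ 2 = ‖z.1‖ ^ 2 * ‖f z.1‖ ^ 2 * (‖z.2‖ ^ 2)⁻¹ := by
      field_simp
    have e3 : (‖z.2‖ * ‖f z.2‖ / ‖z.1‖) ^ 2 = ‖z.2‖ ^ 2 * ‖f z.2‖ ^ 2 * (‖z.1‖ ^ 2)⁻¹ := by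
      field_simp
    rw [e1, e2, e3] at key
    have : 0 ≤ ‖f z.1‖ * ‖f z.2‖ := by positivity
    linarith

/-- As `Q + λ ≥ (|p|² + |q|²)/2`, the Schur bound is `w = 2C/|p|`, and `|p|² w` is a multiple of
`|p|`: exactly the `H^{1/2}` weight. -/
theorem integrable_offIntegrand {ξ : L2R3} (hξ : MemHHalf ξ) {lam : ℝ} (hlam : 0 < lam) :
    Integrable (offIntegrand lam ξ) := by
  obtain ⟨C, hC0, hC⟩ := exists_lintegral_inv_norm_sq_mul_le
  have hm := continuous_offForm.measurable
  have hpos : ∀ z, 0 < offForm z + lam := fun z => by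
    nlinarith [half_sq_le_offForm z, sq_nonneg ‖z.1‖, sq_nonneg ‖z.2‖]
  have := integrable_of_schur_weight (f := hat ξ) (memLp_hat ξ).1
    (k := fun z => (offForm z + lam)⁻¹) (by fun_prop) (fun z => (inv_pos.2 (hpos z)).le)
    (fun z => by simp only [offForm, Prod.fst_swap, Prod.snd_swap, real_inner_comm]; ring_nf)
    (w := fun p => 2 * (C / ‖p‖)) (fun p hp => ?_) ?_
  · refine this.congr (.of_forall fun z => ?_)
    simp only [offIntegrand, offForm, div_eq_mul_inv, Complex.ofReal_inv]
  · have hp' : 0 < ‖p‖ := norm_pos_iff.2 hp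
    calc ∫⁻ q, ENNReal.ofReal ((‖q‖ ^ 2)⁻¹ * (offForm (p, q) + lam)⁻¹)
        ≤ ∫⁻ q, 2 * ENNReal.ofReal ((‖q‖ ^ 2)⁻¹ * (‖p‖ ^ 2 + ‖q‖ ^ 2)⁻¹) := by
          refine lintegral_mono fun q => ?_
          rw [← ofReal_two_mul, mul_left_comm]
          refine ENNReal.ofReal_le_ofReal (mul_le_mul_of_nonneg_left ?_ (by positivity))
          rw [show (2 : ℝ) * (‖p‖ ^ 2 + ‖q‖ ^ 2)⁻¹ = ((‖p‖ ^ 2 + ‖q‖ ^ 2) / 2)⁻¹ by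
            field_simp]
          refine inv_anti₀ (by positivity) ?_
          have := half_sq_le_offForm (p, q)
          simp only at this
          linarith
      _ = 2 * ∫⁻ q : R3, ENNReal.ofReal ((‖q‖ ^ 2)⁻¹ * (‖p‖ ^ 2 + ‖q‖ ^ 2)⁻¹) := by
          rw [lintegral_const_mul _ (by fun_prop)]
      _ ≤ 2 * ENNReal.ofReal (C / ‖p‖) := by gcongr; exact hC _ hp'
      _ = _ := (ofReal_two_mul _).symm
  · refine ((integrable_norm_mul_norm_hat_sq hξ).const_mul (2 * C)).congr (.of_forall fun p => ?_)
    rcases eq_or_ne p 0 with rfl | hp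
    · simp
    have hp' : 0 < ‖p‖ := norm_pos_iff.2 hp
    field_simp

theorem integrable_regIntegrand {ξ : L2R3} (hξ : MemHHalf ξ) :
    Integrable (regIntegrand ξ) := by
  obtain ⟨C, hC0, hC⟩ := exists_lintegral_inv_norm_sq_mul_le
  have := integrable_of_schur_weight (f := hat ξ) (memLp_hat ξ).1
    (k := fun z => (‖z.1 - z.2‖ ^ 2)⁻¹) (by fun_prop) (fun z => by positivity)
    (fun z => by simp only [Prod.fst_swap, Prod.snd_swap, norm_sub_rev])
    (w := fun p => 8 * (C / ‖p‖)) (fun p hp => ?_) ?_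
  · refine this.congr (.of_forall fun z => ?_)
    simp only [regIntegrand, div_eq_mul_inv, Complex.ofReal_inv]
  · have hp' : 0 < ‖p‖ / 2 := half_pos (norm_pos_iff.2 hp)
    set g : R3 → ℝ := fun q => (‖q‖ ^ 2)⁻¹ * ((‖p‖ / 2) ^ 2 + ‖q‖ ^ 2)⁻¹ with hg
    -- The kernel is singular at `q = 0` and at `q = p`. The larger of `|q|` and `|p - q|` is at
    -- least `|p|/2`, so each singularity is bounded by a copy of `g` centred there.
    have hbound : ∀ q r : R3, ‖p‖ ≤ ‖q‖ + ‖r‖ → q ≠ 0 → ‖q‖ ≤ ‖r‖ →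
        (‖q‖ ^ 2)⁻¹ * (‖r‖ ^ 2)⁻¹ ≤ 2 * g q := by
      intro q r h1 hq h2
      simp only [hg]
      rw [mul_left_comm]
      refine mul_le_mul_of_nonneg_left ?_ (by positivity)
      rw [show (2 : ℝ) * ((‖p‖ / 2) ^ 2 + ‖q‖ ^ 2)⁻¹ = (((‖p‖ / 2) ^ 2 + ‖q‖ ^ 2) / 2)⁻¹ by
        field_simp]
      refine inv_anti₀ (by positivity) ?_
      have h3 : ‖p‖ / 2 ≤ ‖r‖ := by linarith
      nlinarith [norm_nonneg q]
    have hpt : ∀ q : R3, (‖q‖ ^ 2)⁻¹ * (‖p - q‖ ^ 2)⁻¹ ≤ 2 * g q + 2 * g (p - q) := by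
      intro q
      have hg0 : ∀ r, 0 ≤ g r := fun r => by simp only [hg]; positivity
      have htri : ‖p‖ ≤ ‖q‖ + ‖p - q‖ := by
        simpa using norm_add_le q (p - q)
      -- At either singular point the left side is `0`, because `0⁻¹ = 0`.
      rcases eq_or_ne q 0 with rfl | hq
      · have := hg0 0; have := hg0 (p - 0)
        simp only [norm_zero]; norm_num at *; positivity
      rcases eq_or_ne (p - q) 0 with h0 | hpq
      · have := hg0 q; have := hg0 (p - q)
        rw [h0] at *
        simp only [norm_zero]; norm_num at *; positivity
      rcases le_total ‖q‖ ‖p - q‖ with h | h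
      · linarith [hbound q (p - q) htri hq h, hg0 (p - q)]
      · have := hbound (p - q) q (by linarith) hpq h
        linarith [hg0 q, mul_comm (‖q‖ ^ 2)⁻¹ (‖p - q‖ ^ 2)⁻¹]
    have hgm : Measurable g := by fun_prop
    calc ∫⁻ q, ENNReal.ofReal ((‖q‖ ^ 2)⁻¹ * (‖p - q‖ ^ 2)⁻¹)
        ≤ ∫⁻ q, (2 * ENNReal.ofReal (g q) + 2 * ENNReal.ofReal (g (p - q))) := by
          refine lintegral_mono fun q => ?_
          refine (ENNReal.ofReal_le_ofReal (hpt q)).trans (ENNReal.ofReal_add_le.trans ?_)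
          rw [ofReal_two_mul, ofReal_two_mul]
      _ = 2 * (∫⁻ q, ENNReal.ofReal (g q)) + 2 * ∫⁻ q, ENNReal.ofReal (g q) := by
          rw [lintegral_add_left (by fun_prop), lintegral_const_mul _ (by fun_prop),
            lintegral_const_mul _ (by fun_prop),
            lintegral_sub_left_eq_self (fun q => ENNReal.ofReal (g q)) p]
      _ ≤ 2 * ENNReal.ofReal (C / (‖p‖ / 2)) + 2 * ENNReal.ofReal (C / (‖p‖ / 2)) := by
          gcongr <;> exact hC _ hp'
      _ = _ := by
          rw [← ofReal_two_mul, ← ENNReal.ofReal_add (by positivity) (by positivity)]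
          congr 1
          field_simp
          ring
  · refine ((integrable_norm_mul_norm_hat_sq hξ).const_mul (8 * C)).congr (.of_forall fun p => ?_)
    rcases eq_or_ne p 0 with rfl | hp
    · simp
    have hp' : 0 < ‖p‖ := norm_pos_iff.2 hp
    field_simp

/-- `Q⁻²` is, up to a constant, the `λ = 0` limit of the position kernel. It has degree `-4`, so the
Schur test requires the weight `1/|x|` in place of `|p|`. -/
theorem integrable_conj_mul_inv_offForm_sq {u : L2R3}
    (hu : Integrable (fun x => ‖u x‖ ^ 2 / ‖x‖)) :
    Integrable (fun z : R3 × R3 => conj (u z.1) * u z.2 * (((offForm z ^ 2)⁻¹ : ℝ) : ℂ)) := by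
  obtain ⟨C, hC0, hC⟩ := exists_lintegral_inv_norm_sq_mul_le
  have hm := continuous_offForm.measurable
  refine integrable_of_schur_weight (Lp.aestronglyMeasurable u)
    (k := fun z => (offForm z ^ 2)⁻¹) (by fun_prop) (fun z => by positivity)
    (fun z => by simp only [offForm, Prod.fst_swap, Prod.snd_swap, real_inner_comm]; ring_nf)
    (w := fun p => 4 * (‖p‖ ^ 2)⁻¹ * (C / ‖p‖)) (fun p hp => ?_) ?_
  · have hp' : 0 < ‖p‖ := norm_pos_iff.2 hp
    calc ∫⁻ q, ENNReal.ofReal ((‖q‖ ^ 2)⁻¹ * (offForm (p, q) ^ 2)⁻¹)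
        ≤ ∫⁻ q, ENNReal.ofReal (4 * (‖p‖ ^ 2)⁻¹) *
            ENNReal.ofReal ((‖q‖ ^ 2)⁻¹ * (‖p‖ ^ 2 + ‖q‖ ^ 2)⁻¹) := by
          refine lintegral_mono fun q => ?_
          rw [← ENNReal.ofReal_mul (by positivity), mul_left_comm]
          refine ENNReal.ofReal_le_ofReal (mul_le_mul_of_nonneg_left ?_ (by positivity))
          rw [show 4 * (‖p‖ ^ 2)⁻¹ * (‖p‖ ^ 2 + ‖q‖ ^ 2)⁻¹ =
            (‖p‖ ^ 2 / 2 * ((‖p‖ ^ 2 + ‖q‖ ^ 2) / 2))⁻¹ by field_simp; norm_num, sq (offForm _)]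
          refine inv_anti₀ (by positivity) ?_
          have := half_sq_le_offForm (p, q)
          simp only at this
          refine mul_le_mul ?_ this (by positivity) ?_ <;> nlinarith [sq_nonneg ‖q‖]
      _ = ENNReal.ofReal (4 * (‖p‖ ^ 2)⁻¹) *
            ∫⁻ q, ENNReal.ofReal ((‖q‖ ^ 2)⁻¹ * (‖p‖ ^ 2 + ‖q‖ ^ 2)⁻¹) := by
          rw [lintegral_const_mul _ (by fun_prop)]
      _ ≤ ENNReal.ofReal (4 * (‖p‖ ^ 2)⁻¹) * ENNReal.ofReal (C / ‖p‖) := by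
          gcongr; exact hC _ hp'
      _ = _ := by rw [ENNReal.ofReal_mul (p := 4 * (‖p‖ ^ 2)⁻¹) (by positivity)]
  · refine (hu.const_mul (4 * C)).congr (.of_forall fun p => ?_)
    rcases eq_or_ne p 0 with rfl | hp
    · simp
    have hp' : 0 < ‖p‖ := norm_pos_iff.2 hp
    field_simp

/-! ### Integration over the subordination parameter -/

/-- Positivity of `K` makes the `t`-integral of `|F K|` equal to `|F| k`, so integrability of `F k`
is already joint integrability. -/
theorem integrable_subordination {X : Type*} [MeasurableSpace X] {μ : Measure X} [SFinite μ]
    {F : X → ℂ} {k : X → ℝ} {K : X → ℝ → ℝ} (hF : AEStronglyMeasurable F μ)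
    (hK : Measurable (Function.uncurry K)) (hK0 : ∀ x, ∀ t > 0, 0 ≤ K x t)
    (hKi : ∀ᵐ x ∂μ, IntegrableOn (K x) (Set.Ioi 0))
    (hKk : ∀ᵐ x ∂μ, ∫ t in Set.Ioi 0, K x t = k x) (hFk : Integrable (fun x => F x * k x) μ) :
    Integrable (Function.uncurry fun x t => F x * (K x t : ℂ))
      (μ.prod (volume.restrict (Set.Ioi 0))) := by
  have hm : AEStronglyMeasurable (Function.uncurry fun x t => F x * (K x t : ℂ))
      (μ.prod (volume.restrict (Set.Ioi 0))) :=
    hF.comp_fst.mul (Complex.measurable_ofReal.comp hK).aestronglyMeasurable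
  refine (integrable_prod_iff hm).2 ⟨?_, ?_⟩
  · filter_upwards [hKi] with x hx
    exact hx.ofReal.const_mul (F x)
  · refine hFk.norm.congr ?_
    filter_upwards [hKk] with x hx
    have h0 : 0 ≤ k x := hx ▸ setIntegral_nonneg measurableSet_Ioi (hK0 x)
    rw [norm_mul, Complex.norm_real, Real.norm_of_nonneg h0, ← hx, ← integral_const_mul]
    refine setIntegral_congr_fun measurableSet_Ioi fun t ht => ?_
    simp only [Function.uncurry, norm_mul, Complex.norm_real, Real.norm_of_nonneg (hK0 x t ht)]

theorem integral_subordination {X : Type*} [MeasurableSpace X] {μ : Measure X} [SFinite μ]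
    {F : X → ℂ} {k : X → ℝ} {K : X → ℝ → ℝ} (hF : AEStronglyMeasurable F μ)
    (hK : Measurable (Function.uncurry K)) (hK0 : ∀ x, ∀ t > 0, 0 ≤ K x t)
    (hKi : ∀ᵐ x ∂μ, IntegrableOn (K x) (Set.Ioi 0))
    (hKk : ∀ᵐ x ∂μ, ∫ t in Set.Ioi 0, K x t = k x) (hFk : Integrable (fun x => F x * k x) μ) :
    ∫ x, F x * k x ∂μ = ∫ t in Set.Ioi 0, ∫ x, F x * (K x t : ℂ) ∂μ := by
  rw [← integral_integral_swap (integrable_subordination hF hK hK0 hKi hKk hFk)]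
  refine integral_congr_ae ?_
  filter_upwards [hKk] with x hx
  rw [integral_const_mul, integral_complex_ofReal, hx]

theorem ae_fst_ne_snd : ∀ᵐ z : R3 × R3, z.1 ≠ z.2 := by
  have h := (measurePreserving_prod_neg_add (volume : Measure R3)
    (volume : Measure R3)).quasiMeasurePreserving.ae
      (Measure.quasiMeasurePreserving_snd.ae ae_ne_zero)
  filter_upwards [h] with z hz h0
  exact hz (by simp [h0])

theorem aestronglyMeasurable_conj_mul {f : R3 → ℂ} (hf : AEStronglyMeasurable f) :
    AEStronglyMeasurable (fun z : R3 × R3 => conj (f z.1) * f z.2) :=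
  (Complex.continuous_conj.comp_aestronglyMeasurable hf).comp_fst.mul hf.comp_snd

theorem regIntegrand_eq (ξ : L2R3) : regIntegrand ξ = fun z =>
    conj (hat ξ z.1) * hat ξ z.2 * (((‖z.1 - z.2‖ ^ 2)⁻¹ : ℝ) : ℂ) := by
  funext z
  simp only [regIntegrand, div_eq_mul_inv, Complex.ofReal_inv]

/-- The Hardy-type bound comes with the identity: at each `t` the momentum form equals `∫ g x t dx`
with `g ≥ 0`, so its integrability in `t` makes `g` jointly integrable, and integrating `t` first
gives `2π² |ξ|²/|x|`. -/
theorem hardy_and_integral_regIntegrand {ξ : L2R3} (hξ : MemHHalf ξ) :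
    Integrable (fun x => ‖ξ x‖ ^ 2 / ‖x‖) ∧
      ∫ z, regIntegrand ξ z = ((2 * π ^ 2 * ∫ x, ‖ξ x‖ ^ 2 / ‖x‖ : ℝ) : ℂ) := by
  have hR := integrable_regIntegrand hξ
  rw [regIntegrand_eq] at hR ⊢
  have hF := aestronglyMeasurable_conj_mul (memLp_hat ξ).1
  have hK : Measurable (Function.uncurry fun (z : R3 × R3) (t : ℝ) =>
      rexp (-t * ‖z.1 - z.2‖ ^ 2)) := by
    unfold Function.uncurry; fun_prop
  have hsq : ∀ᵐ z : R3 × R3, 0 < ‖z.1 - z.2‖ ^ 2 := by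
    filter_upwards [ae_fst_ne_snd] with z hz
    have := norm_pos_iff.2 (sub_ne_zero.2 hz)
    positivity
  have hKi := hsq.mono fun z hz => integrableOn_exp_neg_mul_Ioi_zero hz
  have hKk := hsq.mono fun z hz => integral_exp_neg_mul_Ioi_zero hz
  have hpos : ∀ z : R3 × R3, ∀ t > 0, 0 ≤ rexp (-t * ‖z.1 - z.2‖ ^ 2) :=
    fun z t _ => by positivity
  have hint := (integrable_subordination hF hK hpos hKi hKk hR).integral_prod_right
  have heq := integral_subordination hF hK hpos hKi hKk hR
  simp only [Function.uncurry] at hint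
  set g : R3 → ℝ → ℝ := fun x t =>
    ‖ξ x‖ ^ 2 * ((π / t) ^ (3 / 2 : ℝ) * rexp (-‖x‖ ^ 2 / (4 * t))) with hg
  have hform : ∀ t ∈ Set.Ioi (0 : ℝ), ∫ z : R3 × R3,
      conj (hat ξ z.1) * hat ξ z.2 * (rexp (-t * ‖z.1 - z.2‖ ^ 2) : ℝ) =
      ((∫ x, g x t : ℝ) : ℂ) := by
    intro t ht
    rw [integral_hat_gaussian_sub ξ ht, ← integral_const_mul]
    congr 2
    funext x
    simp only [hg]
    ring
  have hgint : IntegrableOn (fun t => ∫ x, g x t) (Set.Ioi 0) := by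
    have := (hint.congr (ae_restrict_of_forall_mem measurableSet_Ioi hform)).re
    unfold IntegrableOn
    simpa using this
  have hgm : AEStronglyMeasurable (Function.uncurry g)
      ((volume : Measure R3).prod (volume.restrict (Set.Ioi 0))) := by
    refine AEStronglyMeasurable.mul ((Lp.aestronglyMeasurable ξ).comp_fst.norm.pow 2) ?_
    exact Measurable.aestronglyMeasurable (by fun_prop)
  have hg0 : ∀ x, ∀ t > 0, 0 ≤ g x t := fun x t ht => by
    have : 0 < t := ht
    simp only [hg]; positivity
  have hgI : Integrable (Function.uncurry g)
      ((volume : Measure R3).prod (volume.restrict (Set.Ioi 0))) := by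
    refine (integrable_prod_iff' hgm).2 ⟨?_, ?_⟩
    · filter_upwards [ae_restrict_mem measurableSet_Ioi] with t (ht : 0 < t)
      refine ((integrable_norm_sq_Lp ξ).mul_const ((π / t) ^ (3 / 2 : ℝ))).mono' ?_
        (.of_forall fun x => ?_)
      · refine AEStronglyMeasurable.mul ((Lp.aestronglyMeasurable ξ).norm.pow 2) ?_
        exact Measurable.aestronglyMeasurable (by fun_prop)
      · simp only [Function.uncurry]
        rw [Real.norm_of_nonneg (hg0 x t ht)]
        simp only [hg]
        refine mul_le_mul_of_nonneg_left (mul_le_of_le_one_right (by positivity) ?_)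
          (by positivity)
        rw [Real.exp_le_one_iff]
        exact div_nonpos_of_nonpos_of_nonneg (by simp) (by positivity)
    · refine hgint.congr (ae_restrict_of_forall_mem measurableSet_Ioi fun t ht => ?_)
      refine integral_congr_ae (.of_forall fun x => ?_)
      simp only [Function.uncurry]
      rw [Real.norm_of_nonneg (hg0 x t ht)]
  have hgt : ∀ᵐ x : R3, ∫ t in Set.Ioi 0, g x t = 2 * π ^ 2 * (‖ξ x‖ ^ 2 / ‖x‖) := by
    filter_upwards [ae_ne_zero] with x hx
    simp only [hg]
    rw [integral_const_mul, integral_rpow_mul_exp_neg_sq_div (norm_pos_iff.2 hx)]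
    ring
  constructor
  · have := (hgI.integral_prod_left.congr hgt).const_mul (2 * π ^ 2)⁻¹
    refine this.congr (.of_forall fun x => ?_)
    simp only
    field_simp
  · rw [heq, setIntegral_congr_fun measurableSet_Ioi hform, integral_complex_ofReal,
      ← integral_integral_swap hgI, integral_congr_ae hgt, integral_const_mul]

theorem measurable_macdonaldK (ν : ℝ) : Measurable (macdonaldK ν) := by
  unfold macdonaldK
  refine StronglyMeasurable.measurable ?_
  refine StronglyMeasurable.integral_prod_right
    (f := fun x t => rexp (-x * Real.cosh t) * Real.cosh (ν * t)) ?_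
  exact Continuous.stronglyMeasurable (by unfold Function.uncurry; fun_prop)

/-- Here `a = l` and `b = q/3`; the `3` is the one in `e^{-Q/(3t)}`. -/
theorem macdonaldK_two_subordination {l q : ℝ} (hl : 0 < l) (hq : 0 < q) :
    ∫ t in Set.Ioi (0 : ℝ), (t ^ 3)⁻¹ * rexp (-l * t + -(q / 3) / t) =
      6 * l * (q⁻¹ * macdonaldK 2 (√(4 * l / 3) * √q)) := by
  rw [integral_inv_cube_mul_exp_add hl (by positivity)]
  have : √(4 * l / 3) * √q = 2 * √(l * (q / 3)) := by
    rw [← Real.sqrt_mul (by positivity), show 4 * l / 3 * q = 2 ^ 2 * (l * (q / 3)) by ring,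
      Real.sqrt_mul (by positivity), Real.sqrt_sq (by norm_num)]
  rw [this]
  field_simp
  ring

theorem offPosIntegrand_eq (lam : ℝ) (ξ : L2R3) : offPosIntegrand lam ξ = fun z =>
    conj (ξ z.1) * ξ z.2 *
      (((offForm z)⁻¹ * macdonaldK 2 (√(4 * lam / 3) * √(offForm z)) : ℝ) : ℂ) := by
  funext z
  have : ‖z.2‖ ^ 2 + ‖z.1‖ ^ 2 + inner ℝ z.1 z.2 = offForm z := by
    unfold offForm; ring
  simp only [offPosIntegrand, this]
  push_cast
  ring

theorem integrable_off_and_integral_offIntegrand {ξ : L2R3} (hξ : MemHHalf ξ) {lam : ℝ}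
    (hlam : 0 < lam) :
    Integrable (offPosIntegrand lam ξ) ∧
      ∫ z, offIntegrand lam ξ z = ((3 : ℝ) ^ (-(3 / 2) : ℝ) * (6 * lam) : ℝ) *
        ∫ z, offPosIntegrand lam ξ z := by
  have hO := integrable_offIntegrand hξ hlam
  have hOeq : offIntegrand lam ξ = fun z =>
      conj (hat ξ z.1) * hat ξ z.2 * (((offForm z + lam)⁻¹ : ℝ) : ℂ) := by
    funext z
    simp only [offIntegrand, offForm, div_eq_mul_inv, Complex.ofReal_inv]
  rw [hOeq] at hO ⊢
  have hm := continuous_offForm.measurable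
  have hnn : ∀ z, 0 ≤ offForm z := fun z => by
    nlinarith [half_sq_le_offForm z, sq_nonneg ‖z.1‖, sq_nonneg ‖z.2‖]
  have hsq : ∀ᵐ z : R3 × R3, 0 < offForm z := by
    filter_upwards [ae_fst_ne_zero] with z hz
    have : 0 < ‖z.1‖ := norm_pos_iff.2 hz
    nlinarith [half_sq_le_offForm z, sq_nonneg ‖z.2‖, sq_pos_of_pos this]
  set kx : R3 × R3 → ℝ := fun z =>
    6 * lam * ((offForm z)⁻¹ * macdonaldK 2 (√(4 * lam / 3) * √(offForm z))) with hkx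
  set K : R3 × R3 → ℝ → ℝ := fun z t =>
    (t ^ 3)⁻¹ * rexp (-lam * t + -(offForm z / 3) / t) with hKdef
  have hFx := aestronglyMeasurable_conj_mul (Lp.aestronglyMeasurable ξ)
  have hK : Measurable (Function.uncurry K) := by
    simp only [hKdef]; unfold Function.uncurry; fun_prop
  have hK0 : ∀ z, ∀ t > 0, 0 ≤ K z t := fun z t ht => by
    have : 0 < t := ht
    simp only [hKdef]; positivity
  have hKi : ∀ᵐ z : R3 × R3, IntegrableOn (K z) (Set.Ioi 0) :=
    hsq.mono fun z hz => integrableOn_inv_cube_mul_exp_add hlam.le (by positivity)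
  have hKk : ∀ᵐ z : R3 × R3, ∫ t in Set.Ioi 0, K z t = kx z :=
    hsq.mono fun z hz => macdonaldK_two_subordination hlam hz
  have hkxm : Measurable kx := by
    have := measurable_macdonaldK 2
    simp only [hkx]; fun_prop
  -- Dropping `e^{-λt}` from `K` bounds `kx` by `9 Q⁻²`.
  have hFk : Integrable (fun z : R3 × R3 => conj (ξ z.1) * ξ z.2 * (kx z : ℂ)) := by
    refine ((integrable_conj_mul_inv_offForm_sq
      (hardy_and_integral_regIntegrand hξ).1).norm.const_mul 9).mono' ?_ ?_
    · exact hFx.mul (Complex.measurable_ofReal.comp hkxm).aestronglyMeasurable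
    · filter_upwards [hsq, hKi, hKk] with z hz hi hk
      have h0 : 0 ≤ kx z := hk ▸ setIntegral_nonneg measurableSet_Ioi (hK0 z)
      rw [norm_mul, norm_mul (_ * _), Complex.norm_real, Complex.norm_real,
        Real.norm_of_nonneg h0, Real.norm_of_nonneg (by positivity), mul_left_comm (9 : ℝ)]
      refine mul_le_mul_of_nonneg_left ?_ (norm_nonneg _)
      have hb : 0 < offForm z / 3 := by positivity
      have e : 9 * (offForm z ^ 2)⁻¹ = ((offForm z / 3) ^ 2)⁻¹ := by field_simp; norm_num
      rw [← hk, e, ← integral_inv_cube_mul_exp hb]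
      refine setIntegral_mono_on hi (integrableOn_inv_cube_mul_exp hb) measurableSet_Ioi
        fun t (ht : 0 < t) => ?_
      simp only [hKdef]
      gcongr
      nlinarith
  have hPos : (fun z => conj (ξ z.1) * ξ z.2 * (kx z : ℂ)) =
      fun z => ((6 * lam : ℝ) : ℂ) * offPosIntegrand lam ξ z := by
    rw [offPosIntegrand_eq]
    funext z
    simp only [hkx]
    push_cast
    ring
  refine ⟨?_, ?_⟩
  · rw [hPos] at hFk
    refine (hFk.const_mul ((6 * lam : ℝ) : ℂ)⁻¹).congr (.of_forall fun z => ?_)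
    have : ((6 * lam : ℝ) : ℂ) ≠ 0 := by exact_mod_cast (by positivity : 6 * lam ≠ 0)
    simp only
    rw [inv_mul_cancel_left₀ this]
  · have hp : ∀ z, 0 < offForm z + lam := fun z => by linarith [hnn z]
    rw [integral_subordination (K := fun z t => rexp (-t * (offForm z + lam)))
      (aestronglyMeasurable_conj_mul (memLp_hat ξ).1) (by unfold Function.uncurry; fun_prop)
      (fun z t _ => by positivity)
      (.of_forall fun z => integrableOn_exp_neg_mul_Ioi_zero (hp z))
      (.of_forall fun z => integral_exp_neg_mul_Ioi_zero (hp z)) hO]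
    rw [Complex.ofReal_mul, mul_assoc, ← integral_const_mul, ← hPos,
      integral_subordination hFx hK hK0 hKi hKk hFk, ← integral_const_mul]
    -- Both sides are now `t`-integrals with the common factor `e^{-λt}`, so the Gaussian identity
    -- at fixed `t` suffices.
    refine setIntegral_congr_fun measurableSet_Ioi fun t (ht : 0 < t) => ?_
    have key := integral_hat_exp_offForm ξ ht
    have e1 : ∀ z : R3 × R3, conj (hat ξ z.1) * hat ξ z.2 *
        (rexp (-t * (offForm z + lam)) : ℝ) = (rexp (-lam * t) : ℝ) *
        (conj (hat ξ z.1) * hat ξ z.2 * (rexp (-t * offForm z) : ℝ)) := by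
      intro z
      rw [show -t * (offForm z + lam) = -lam * t + -t * offForm z by ring, Real.exp_add]
      push_cast
      ring
    have e2 : ∀ z : R3 × R3, conj (ξ z.1) * ξ z.2 * (K z t : ℂ) =
        ((rexp (-lam * t) * (t ^ 3)⁻¹ : ℝ) : ℂ) *
        (conj (ξ z.1) * ξ z.2 * (rexp (-(3 * t)⁻¹ * offForm z) : ℝ)) := by
      intro z
      simp only [hKdef]
      rw [show -(3 * t)⁻¹ * offForm z = -(offForm z / 3) / t by field_simp, Real.exp_add]
      push_cast
      ring
    simp only [e1, e2]
    rw [integral_const_mul, integral_const_mul, key, ← mul_assoc, ← mul_assoc,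
      ← Complex.ofReal_mul, ← Complex.ofReal_mul]
    congr 2
    have : ((3 * t ^ 2) ^ (-(3 / 2) : ℝ) : ℝ) = 3 ^ (-(3 / 2) : ℝ) * (t ^ 3)⁻¹ := by
      rw [Real.mul_rpow (by norm_num) (by positivity), ← Real.rpow_natCast t 2,
        ← Real.rpow_mul ht.le, ← Real.rpow_natCast t 3, ← Real.rpow_neg ht.le]
      norm_num
    rw [this]
    ring

/-! ### The diagonal term -/

theorem integral_gaussian_R3 {s : ℝ} (hs : 0 < s) (a : R3) :
    ∫ x : R3, rexp (-s * ‖x - a‖ ^ 2) = (π / s) ^ (3 / 2 : ℝ) := by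
  rw [integral_sub_right_eq_self (fun x : R3 => rexp (-s * ‖x‖ ^ 2)) a,
    GaussianFourier.integral_rexp_neg_mul_sq_norm hs]
  simp

/-- Expanding the square, each pure term integrates to `(π/s)^{3/2} ‖ξ‖²`, which Plancherel rewrites
through `hat ξ`; the cross term is `integral_gaussian_sub`. -/
theorem gagliardo_gaussian (ξ : L2R3) {s : ℝ} (hs : 0 < s) :
    Integrable (fun z : R3 × R3 => ‖ξ z.1 - ξ z.2‖ ^ 2 * rexp (-s * ‖z.1 - z.2‖ ^ 2)) ∧
    ∫ z : R3 × R3, ‖ξ z.1 - ξ z.2‖ ^ 2 * rexp (-s * ‖z.1 - z.2‖ ^ 2) =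
      2 * (π / s) ^ (3 / 2 : ℝ) * ∫ p, ‖hat ξ p‖ ^ 2 * (1 - rexp (-‖p‖ ^ 2 / (4 * s))) := by
  set G : R3 × R3 → ℝ := fun z => ‖ξ z.1‖ ^ 2 * rexp (-s * ‖z.1 - z.2‖ ^ 2) with hG
  set M : R3 × R3 → ℂ := fun z => conj (ξ z.1) * ξ z.2 * (rexp (-s * ‖z.1 - z.2‖ ^ 2) : ℝ) with hM
  have h1 : Integrable G := integrable_norm_sq_mul_gaussian (Lp.memLp ξ) hs
  have h2 : Integrable M := integrable_mul_gaussian_sub (Lp.memLp ξ) hs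
  have hfun : (fun z : R3 × R3 => ‖ξ z.1 - ξ z.2‖ ^ 2 * rexp (-s * ‖z.1 - z.2‖ ^ 2)) =
      fun z => G z + G z.swap - 2 * RCLike.re (M z) := by
    funext z
    simp only [hG, hM, Prod.fst_swap, Prod.snd_swap, norm_sub_rev z.2 z.1]
    have := @norm_sub_sq ℂ ℂ _ _ _ (ξ z.1) (ξ z.2)
    rw [this, RCLike.inner_apply]
    simp only [RCLike.re_to_complex, Complex.re_mul_ofReal]
    rw [mul_comm (ξ z.2)]
    ring
  have hI : ∫ z, G z = (π / s) ^ (3 / 2 : ℝ) * ‖ξ‖ ^ 2 := by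
    rw [Measure.volume_eq_prod] at h1 ⊢
    rw [integral_prod _ h1]
    have e : ∀ x : R3, ∫ y, G (x, y) = (π / s) ^ (3 / 2 : ℝ) * ‖ξ x‖ ^ 2 := by
      intro x
      simp only [hG]
      rw [integral_const_mul, mul_comm, ← integral_gaussian_R3 hs x]
      simp_rw [norm_sub_rev x]
    simp_rw [e]
    rw [integral_const_mul, integral_norm_sq_Lp]
  have hvi : Integrable (fun p => ‖hat ξ p‖ ^ 2 * rexp (-‖p‖ ^ 2 / (4 * s))) := by
    refine (integrable_norm_hat_sq ξ).mono' ?_ (.of_forall fun p => ?_)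
    · refine AEStronglyMeasurable.mul (integrable_norm_hat_sq ξ).1 (by fun_prop)
    · rw [Real.norm_of_nonneg (by positivity)]
      refine mul_le_of_le_one_right (by positivity) ?_
      rw [Real.exp_le_one_iff]
      exact div_nonpos_of_nonpos_of_nonneg (by simp) (by positivity)
  rw [hfun]
  refine ⟨(h1.add h1.swap).sub (h2.re.const_mul 2), ?_⟩
  have hswap : ∫ z : R3 × R3, G z.swap = ∫ z, G z := by
    rw [Measure.volume_eq_prod]
    exact integral_prod_swap G
  have hre : ∫ z, RCLike.re (M z) =
      (π / s) ^ (3 / 2 : ℝ) * ∫ p, ‖hat ξ p‖ ^ 2 * rexp (-‖p‖ ^ 2 / (4 * s)) := by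
    rw [integral_re h2, hM, integral_gaussian_sub ξ hs]
    simp only [RCLike.re_to_complex, Complex.ofReal_re]
  have e1 := integral_sub (h1.add h1.swap) (h2.re.const_mul 2)
  have e2 := integral_add h1 h1.swap
  simp only [Pi.add_apply, Function.comp_apply] at e1 e2
  rw [e1, e2, hswap, hI, integral_const_mul, hre]
  simp_rw [mul_sub, mul_one]
  rw [integral_sub (integrable_norm_hat_sq ξ) hvi, integral_norm_hat_sq]
  ring

theorem integrable_diagIntegrand {ξ : L2R3} (hξ : MemHHalf ξ) {lam : ℝ} (hlam : 0 < lam) :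
    Integrable (diagIntegrand lam ξ) := by
  have h := (integrable_norm_mul_norm_hat_sq hξ).add
    ((integrable_norm_hat_sq ξ).const_mul (√lam))
  refine h.mono' ?_ (.of_forall fun p => ?_)
  · exact AEStronglyMeasurable.mul (by fun_prop) (integrable_norm_hat_sq ξ).1
  · simp only [diagIntegrand, Pi.add_apply]
    rw [Real.norm_of_nonneg (by positivity), ← add_mul]
    refine mul_le_mul_of_nonneg_right ?_ (by positivity)
    refine Real.sqrt_le_iff.2 ⟨by positivity, ?_⟩
    have := Real.sq_sqrt hlam.le
    nlinarith [mul_nonneg (norm_nonneg p) (Real.sqrt_nonneg lam), sq_nonneg ‖p‖]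

/-- Working with `∫⁻` permits both exchanges of integration before the position integrand is known
to be integrable; the finite right side supplies that integrability afterwards. -/
theorem lintegral_diagPosIntegrand {ξ : L2R3} (hξ : MemHHalf ξ) {lam : ℝ} (hlam : 0 < lam) :
    ∫⁻ z, ENNReal.ofReal (6 * lam * diagPosIntegrand lam ξ z) =
      ENNReal.ofReal (2 * (3 * π) ^ (3 / 2 : ℝ) * (2 * √π) *
        ((∫ p, diagIntegrand lam ξ p) - √lam * ‖ξ‖ ^ 2)) := by
  have hξm : StronglyMeasurable (ξ : R3 → ℂ) := Lp.stronglyMeasurable ξ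
  have hm1 : Measurable fun z : R3 × R3 => ‖ξ z.1 - ξ z.2‖ ^ 2 :=
    ((hξm.measurable.comp measurable_fst).sub
      (hξm.measurable.comp measurable_snd)).norm.pow_const 2
  have hm2 : Measurable (hat ξ) := (stronglyMeasurable_hat ξ).measurable
  have hz : ∀ z : R3 × R3, ENNReal.ofReal (6 * lam * diagPosIntegrand lam ξ z) =
      ∫⁻ t in Set.Ioi (0 : ℝ), ENNReal.ofReal (‖ξ z.1 - ξ z.2‖ ^ 2 *
        ((t ^ 3)⁻¹ * rexp (-lam * t + -(‖z.1 - z.2‖ ^ 2 / 3) / t))) := by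
    intro z
    -- On the diagonal both sides vanish with `ξ z.1 - ξ z.2`.
    rcases eq_or_ne z.1 z.2 with h | h
    · simp [diagPosIntegrand, h]
    have hr : 0 < ‖z.1 - z.2‖ := norm_pos_iff.2 (sub_ne_zero.2 h)
    have hr2 : 0 < ‖z.1 - z.2‖ ^ 2 := by positivity
    rw [← ofReal_integral_eq_lintegral_ofReal, integral_const_mul,
      macdonaldK_two_subordination hlam hr2, Real.sqrt_sq hr.le]
    · congr 1
      simp only [diagPosIntegrand]
      ring
    · exact (integrableOn_inv_cube_mul_exp_add hlam.le (by positivity)).const_mul _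
    · filter_upwards [ae_restrict_mem measurableSet_Ioi] with t (ht : 0 < t)
      positivity
  simp_rw [hz]
  rw [lintegral_lintegral_swap]
  swap
  · refine Measurable.aemeasurable ?_
    unfold Function.uncurry
    fun_prop
  have ht : ∀ t ∈ Set.Ioi (0 : ℝ), ∫⁻ z : R3 × R3, ENNReal.ofReal (‖ξ z.1 - ξ z.2‖ ^ 2 *
        ((t ^ 3)⁻¹ * rexp (-lam * t + -(‖z.1 - z.2‖ ^ 2 / 3) / t))) =
      ∫⁻ p : R3, ENNReal.ofReal (2 * (3 * π) ^ (3 / 2 : ℝ) * ‖hat ξ p‖ ^ 2 *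
        (t ^ (-(3 / 2) : ℝ) * rexp (-lam * t) * (1 - rexp (-(3 / 4 * ‖p‖ ^ 2) * t)))) := by
    intro t (ht : 0 < t)
    -- With `s = (3t)⁻¹` the momentum exponent `|p|²/(4s)` becomes `¾|p|² t`, the source of the `¾`
    -- under the square root.
    have hs : 0 < (3 * t)⁻¹ := by positivity
    obtain ⟨hI, hE⟩ := gagliardo_gaussian ξ hs
    have e1 : ∀ z : R3 × R3, ‖ξ z.1 - ξ z.2‖ ^ 2 *
        ((t ^ 3)⁻¹ * rexp (-lam * t + -(‖z.1 - z.2‖ ^ 2 / 3) / t)) =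
        ((t ^ 3)⁻¹ * rexp (-lam * t)) *
          (‖ξ z.1 - ξ z.2‖ ^ 2 * rexp (-(3 * t)⁻¹ * ‖z.1 - z.2‖ ^ 2)) := by
      intro z
      rw [Real.exp_add, show -(‖z.1 - z.2‖ ^ 2 / 3) / t = -(3 * t)⁻¹ * ‖z.1 - z.2‖ ^ 2 by
        field_simp]
      ring
    have hc : (t ^ 3)⁻¹ * (π / (3 * t)⁻¹) ^ (3 / 2 : ℝ) =
        (3 * π) ^ (3 / 2 : ℝ) * t ^ (-(3 / 2) : ℝ) := by
      rw [show π / (3 * t)⁻¹ = (3 * π) * t by field_simp,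
        Real.mul_rpow (by positivity) ht.le, mul_left_comm, ← Real.rpow_natCast t 3,
        ← Real.rpow_neg ht.le, ← Real.rpow_add ht]
      norm_num
    simp_rw [e1]
    have hle : ∀ p : R3, rexp (-(3 / 4 * ‖p‖ ^ 2) * t) ≤ 1 := fun p => by
      rw [Real.exp_le_one_iff]; nlinarith [mul_nonneg (sq_nonneg ‖p‖) ht.le]
    rw [← ofReal_integral_eq_lintegral_ofReal (hI.const_mul _)
      (.of_forall fun z => by simp only [Pi.zero_apply]; positivity), integral_const_mul, hE,
      ← ofReal_integral_eq_lintegral_ofReal]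
    · congr 1
      rw [← integral_const_mul, ← integral_const_mul]
      refine integral_congr_ae (.of_forall fun p => ?_)
      simp only
      rw [show -‖p‖ ^ 2 / (4 * (3 * t)⁻¹) = -(3 / 4 * ‖p‖ ^ 2) * t by field_simp]
      linear_combination (2 * rexp (-lam * t) * ‖hat ξ p‖ ^ 2 *
        (1 - rexp (-(3 / 4 * ‖p‖ ^ 2) * t))) * hc
    · refine ((integrable_norm_hat_sq ξ).const_mul
        (2 * (3 * π) ^ (3 / 2 : ℝ) * (t ^ (-(3 / 2) : ℝ) * rexp (-lam * t)))).mono' ?_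
        (.of_forall fun p => ?_)
      · exact Measurable.aestronglyMeasurable (by fun_prop)
      · have h0 : 0 ≤ 1 - rexp (-(3 / 4 * ‖p‖ ^ 2) * t) := by linarith [hle p]
        have h1 : 1 - rexp (-(3 / 4 * ‖p‖ ^ 2) * t) ≤ 1 := by
          linarith [Real.exp_pos (-(3 / 4 * ‖p‖ ^ 2) * t)]
        rw [Real.norm_of_nonneg (by positivity)]
        calc _ = (2 * (3 * π) ^ (3 / 2 : ℝ) * (t ^ (-(3 / 2) : ℝ) * rexp (-lam * t)) *
              ‖hat ξ p‖ ^ 2) * (1 - rexp (-(3 / 4 * ‖p‖ ^ 2) * t)) := by ring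
          _ ≤ _ := mul_le_of_le_one_right (by positivity) h1
    · refine .of_forall fun p => ?_
      have h0 : 0 ≤ 1 - rexp (-(3 / 4 * ‖p‖ ^ 2) * t) := by linarith [hle p]
      simp only [Pi.zero_apply]
      positivity
  rw [setLIntegral_congr_fun measurableSet_Ioi ht, lintegral_lintegral_swap]
  swap
  · refine Measurable.aemeasurable ?_
    unfold Function.uncurry
    fun_prop
  have hp : ∀ p : R3, ∫⁻ t in Set.Ioi (0 : ℝ),
      ENNReal.ofReal (2 * (3 * π) ^ (3 / 2 : ℝ) * ‖hat ξ p‖ ^ 2 *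
        (t ^ (-(3 / 2) : ℝ) * rexp (-lam * t) * (1 - rexp (-(3 / 4 * ‖p‖ ^ 2) * t)))) =
      ENNReal.ofReal (2 * (3 * π) ^ (3 / 2 : ℝ) * (2 * √π) *
        (diagIntegrand lam ξ p - √lam * ‖hat ξ p‖ ^ 2)) := by
    intro p
    simp_rw [ENNReal.ofReal_mul (by positivity : 0 ≤ 2 * (3 * π) ^ (3 / 2 : ℝ) * ‖hat ξ p‖ ^ 2)]
    rw [lintegral_const_mul _ (by fun_prop), lintegral_subordination_sqrt (by positivity) hlam,
      ← ENNReal.ofReal_mul (by positivity)]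
    congr 1
    simp only [diagIntegrand]
    ring
  simp_rw [hp]
  rw [← ofReal_integral_eq_lintegral_ofReal]
  · rw [integral_const_mul, integral_sub (integrable_diagIntegrand hξ hlam)
      ((integrable_norm_hat_sq ξ).const_mul _), integral_const_mul, integral_norm_hat_sq]
  · exact ((integrable_diagIntegrand hξ hlam).sub
      ((integrable_norm_hat_sq ξ).const_mul _)).const_mul _
  · refine .of_forall fun p => ?_
    simp only [Pi.zero_apply, diagIntegrand, ← sub_mul]
    have : √lam ≤ √(3 / 4 * ‖p‖ ^ 2 + lam) := Real.sqrt_le_sqrt (by nlinarith [sq_nonneg ‖p‖])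
    have := sub_nonneg.2 this
    positivity

theorem diagPosIntegrand_nonneg {lam : ℝ} (ξ : L2R3) (z : R3 × R3) :
    0 ≤ diagPosIntegrand lam ξ z := by
  unfold diagPosIntegrand macdonaldK
  have : 0 ≤ ∫ t in Set.Ioi (0 : ℝ), rexp (-(√(4 * lam / 3) * ‖z.1 - z.2‖) * Real.cosh t) *
      Real.cosh (2 * t) := integral_nonneg fun t => by
    have := Real.cosh_pos (2 * t)
    simp only [Pi.zero_apply]; positivity
  positivity

theorem diag_identity {ξ : L2R3} (hξ : MemHHalf ξ) {lam : ℝ} (hlam : 0 < lam) :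
    Integrable (diagPosIntegrand lam ξ) ∧
      6 * lam * ∫ z, diagPosIntegrand lam ξ z =
        2 * (3 * π) ^ (3 / 2 : ℝ) * (2 * √π) *
        ((∫ p, diagIntegrand lam ξ p) - √lam * ‖ξ‖ ^ 2) := by
  have hξm : StronglyMeasurable (ξ : R3 → ℂ) := Lp.stronglyMeasurable ξ
  have hm1 : Measurable fun z : R3 × R3 => ‖ξ z.1 - ξ z.2‖ ^ 2 :=
    ((hξm.measurable.comp measurable_fst).sub
      (hξm.measurable.comp measurable_snd)).norm.pow_const 2
  have hmK := measurable_macdonaldK 2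
  have hm : Measurable (diagPosIntegrand lam ξ) := by
    unfold diagPosIntegrand
    fun_prop
  have hL := lintegral_diagPosIntegrand hξ hlam
  have hnn : ∀ z, 0 ≤ 6 * lam * diagPosIntegrand lam ξ z := fun z => by
    have := diagPosIntegrand_nonneg (lam := lam) ξ z
    positivity
  have hI : Integrable (fun z => 6 * lam * diagPosIntegrand lam ξ z) := by
    refine ⟨(hm.const_mul _).aestronglyMeasurable, ?_⟩
    rw [hasFiniteIntegral_iff_ofReal (.of_forall hnn), hL]
    exact ENNReal.ofReal_lt_top
  -- Needed because `ENNReal.ofReal` truncates negative values.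
  have hdiff : 0 ≤ (∫ p, diagIntegrand lam ξ p) - √lam * ‖ξ‖ ^ 2 := by
    rw [← integral_norm_hat_sq, ← integral_const_mul, ← integral_sub
      (integrable_diagIntegrand hξ hlam) ((integrable_norm_hat_sq ξ).const_mul _)]
    refine integral_nonneg fun p => ?_
    simp only [Pi.zero_apply, diagIntegrand, ← sub_mul]
    have : √lam ≤ √(3 / 4 * ‖p‖ ^ 2 + lam) := Real.sqrt_le_sqrt (by nlinarith [sq_nonneg ‖p‖])
    have := sub_nonneg.2 this
    positivity
  constructor
  · refine (hI.const_mul (6 * lam)⁻¹).congr (.of_forall fun z => ?_)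
    simp only
    field_simp
  · rw [← integral_const_mul, integral_eq_lintegral_of_nonneg_ae (.of_forall hnn) hI.1, hL,
      ENNReal.toReal_ofReal (by positivity)]

end ThreeBoson

/-! ### Assembly of the three identities and their constants. -/

theorem proposition1 (ξ : ThreeBoson.L2R3) (hξ : ThreeBoson.MemHHalf ξ)
    (lam : ℝ) (hlam : 0 < lam) (γ : ℝ) :
    -- all the integrals involved converge absolutely
    (Integrable (ThreeBoson.diagIntegrand lam ξ) ∧
      Integrable (ThreeBoson.offIntegrand lam ξ) ∧
      Integrable (ThreeBoson.regIntegrand ξ) ∧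
      Integrable (ThreeBoson.diagPosIntegrand lam ξ) ∧
      Integrable (ThreeBoson.offPosIntegrand lam ξ) ∧
      Integrable (fun x : ThreeBoson.R3 => ‖ξ x‖ ^ 2 / ‖x‖)) ∧
    -- the position-space representations
    ThreeBoson.PhiDiag lam ξ =
      12 * π * √lam * ‖ξ‖ ^ 2 +
        2 * √3 * lam / π *
          ∫ z : ThreeBoson.R3 × ThreeBoson.R3, ThreeBoson.diagPosIntegrand lam ξ z ∧
    ThreeBoson.PhiOff lam ξ =
      -((8 * √3 * lam / π : ℝ) : ℂ) *
        ∫ z : ThreeBoson.R3 × ThreeBoson.R3, ThreeBoson.offPosIntegrand lam ξ z ∧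
    ThreeBoson.PhiReg γ ξ =
      ((12 * π * γ * ∫ x : ThreeBoson.R3, ‖ξ x‖ ^ 2 / ‖x‖ : ℝ) : ℂ) := by
  obtain ⟨hH, hreg⟩ := ThreeBoson.hardy_and_integral_regIntegrand hξ
  obtain ⟨hO, hoff⟩ := ThreeBoson.integrable_off_and_integral_offIntegrand hξ hlam
  obtain ⟨hD, hdiag⟩ := ThreeBoson.diag_identity hξ hlam
  have hpi := Real.pi_pos
  have h3 : √3 * √3 = 3 := Real.mul_self_sqrt (by norm_num)
  have h3' : 0 < √3 := by positivity
  refine ⟨⟨ThreeBoson.integrable_diagIntegrand hξ hlam, ThreeBoson.integrable_offIntegrand hξ hlam,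
    ThreeBoson.integrable_regIntegrand hξ, hD, hO, hH⟩, ?_, ?_, ?_⟩
  -- This gives `4(3π)^{3/2}√π/6 = 2√3π²`, and multiplying by `2√3/π` produces `12π`.
  · have hc : (3 * π) ^ (3 / 2 : ℝ) * √π = 3 * √3 * π ^ 2 := by
      rw [show (3 / 2 : ℝ) = 1 + 1 / 2 by norm_num, Real.rpow_add (by positivity), Real.rpow_one,
        ← Real.sqrt_eq_rpow, Real.sqrt_mul (by norm_num)]
      linear_combination (3 * π * √3) * Real.mul_self_sqrt hpi.le
    have hJ : lam * ∫ z, ThreeBoson.diagPosIntegrand lam ξ z =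
        2 * √3 * π ^ 2 * ((∫ p, ThreeBoson.diagIntegrand lam ξ p) - √lam * ‖ξ‖ ^ 2) := by
      linear_combination (1 / 6) * hdiag + (2 / 3) *
        ((∫ p, ThreeBoson.diagIntegrand lam ξ p) - √lam * ‖ξ‖ ^ 2) * hc
    rw [ThreeBoson.PhiDiag, div_mul_eq_mul_div, mul_assoc (2 * √3), hJ]
    field_simp
    linear_combination (-4) *
        ((∫ p, ThreeBoson.diagIntegrand lam ξ p) - √lam * ‖ξ‖ ^ 2) * h3
  · rw [ThreeBoson.PhiOff, hoff, ← mul_assoc]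
    congr 1
    rw [neg_mul, ← Complex.ofReal_mul]
    congr 2
    -- The constant is `(12/π) · 3^{-3/2} · 6λ = 8√3λ/π`.
    rw [show (-(3 / 2) : ℝ) = -(1 + 1 / 2) by norm_num, Real.rpow_neg (by norm_num),
      Real.rpow_add (by norm_num), Real.rpow_one, ← Real.sqrt_eq_rpow]
    field_simp
    linear_combination (-24) * h3
  · rw [ThreeBoson.PhiReg, hreg, ← Complex.ofReal_mul]
    congr 1
    field_simp
    ring
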